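/- Let $\Omega\subset\mathbb R^3$ be a bounded open set with boundary of class $C^2$ (locally, after an orthogonal change of coordinates, $\Omega$ is the region on one side of the graph of a $C^2$ function; connectedness is not needed), with outward unit normal $n$ and surface measure $dS$ on $\partial\Omega$. Let $\gamma,\ell,\beta\in\mathbb R$ with $|\gamma|\le 1$, $\ell>0$, $\beta>0$, and put $k=\ell/\beta^2$. With the convention $(\nabla v)_{ij}=\partial_j v_i$ and $A:B=\sum_{i,j}A_{ij}B_{ij}$, define for $u,\phi\in H^2(\Omega)^3$ $$a(u,\phi)=\int_\Omega G:\nabla(\nabla\times\phi)\,dx+k\int_{\partial\Omega}(n\times\omega)\cdot\partial_n\phi\,dS,\qquad \omega=\nabla\times u,\quad G=\nabla\omega+\gamma(\nabla\omega)^\top,$$ where derivatives are weak derivatives and the boundary values of $\omega$ and of $\partial_n\phi=(\nabla\phi)n$ are taken in the sense of traces of $H^1(\Omega)$ functions: $g\in L^2(\partial\Omega)$ is the trace of $w\in H^1(\Omega)$ if some sequence $s_m\in C^\infty(\mathbb R^3)$ satisfies $s_m\to w$ in $H^1(\Omega)$ and $s_m|_{\partial\Omega}\to g$ in $L^2(\partial\Omega)$.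 Then the form is well defined and bilinear: there is exactly one outward unit normal at each boundary point, every $w\in H^1(\Omega)$ has a trace, which is unique $dS$-almost everywhere, and $a$ is bilinear on $H^2(\Omega)^3$. Moreover: (a) There exists $C>0$ such that $$|a(u,\phi)|\le C\,\|u\|_{H^2(\Omega)}\,\|\phi\|_{H^2(\Omega)}\qquad\text{for all }u,\phi\in H^2(\Omega)^3.$$ (b) For every $u\in H^2(\Omega)^3\cap H^1_0(\Omega)^3$ one has $\omega=n\times\partial_n u$ $dS$-almost everywhere on $\partial\Omega$, and for all $u,\phi\in H^2(\Omega)^3\cap H^1_0(\Omega)^3$ $$a(u,\phi)=a(\phi,u).$$ -/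

import Mathlib

open MeasureTheory Set Filter Topology
open scoped ContDiff Matrix

noncomputable section

namespace WallEddy

/-- Euclidean three-space. -/
abbrev E3 := EuclideanSpace ℝ (Fin 3)

/-- The `j`-th standard unit vector. -/
def unitVec (j : Fin 3) : E3 := EuclideanSpace.single j 1

/-- The classical `j`-th partial derivative. -/
def classicalPartial (j : Fin 3) (f : E3 → ℝ) (x : E3) : ℝ := fderiv ℝ f x (unitVec j)

/-! ### Domains with boundary of class `C²`, outward normal, surface measure -/

/-- The boundary of `Ω` is of class `C²`: near each boundary point, after an orthogonal change of
coordinates, `Ω` is the region strictly above the graph of a `C²` function of two variables. -/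
def HasC2Boundary (Ω : Set E3) : Prop :=
  ∀ x ∈ frontier Ω, ∃ (e : E3 ≃ₗᵢ[ℝ] E3) (r : ℝ) (g : EuclideanSpace ℝ (Fin 2) → ℝ),
    0 < r ∧ ContDiff ℝ 2 g ∧
      ∀ y ∈ Metric.ball x r, (y ∈ Ω ↔ g !₂[e y 0, e y 1] < e y 2)

/-- `n` is an outward unit normal of `Ω` at `x`: a unit vector such that straight paths that leave
`x` in a direction making an obtuse angle with `n` start inside `Ω`, and those that leave `x` in a
direction making an acute angle with `n` start outside `Ω`. There is at most one such vector. -/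
def IsOutwardUnitNormal (Ω : Set E3) (x n : E3) : Prop :=
  ‖n‖ = 1 ∧
    (∀ v : E3, inner ℝ n v < 0 → ∀ᶠ t : ℝ in 𝓝[>] 0, x + t • v ∈ Ω) ∧
    (∀ v : E3, 0 < inner ℝ n v → ∀ᶠ t : ℝ in 𝓝[>] 0, x + t • v ∉ Ω)

open Classical in
/-- The outward unit normal field (zero where there is none, in particular off the boundary). -/
def outwardNormal (Ω : Set E3) (x : E3) : E3 :=
  if h : ∃ n, IsOutwardUnitNormal Ω x n then h.choose else 0

/-- The surface measure of the boundary: two-dimensional Hausdorff measure, normalized so that it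
is Lebesgue measure on planes. -/
def surfaceMeasure (Ω : Set E3) : Measure E3 := μHE[2].restrict (frontier Ω)

/-! ### Sobolev spaces through weak derivatives -/

/-- Lebesgue measure on `Ω`. -/
def volOn (Ω : Set E3) : Measure E3 := (volume : Measure E3).restrict Ω

/-- Real test functions on `Ω`: smooth with compact support contained in `Ω`. -/
def IsTestFunction (Ω : Set E3) (ψ : E3 → ℝ) : Prop :=
  ContDiff ℝ ∞ ψ ∧ HasCompactSupport ψ ∧ tsupport ψ ⊆ Ω

/-- `v ∈ L²(Ω)` is the weak `j`-th partial derivative of `u ∈ L²(Ω)`. -/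
def HasWeakPartial (Ω : Set E3) (j : Fin 3) (u v : E3 → ℝ) : Prop :=
  MemLp u 2 (volOn Ω) ∧ MemLp v 2 (volOn Ω) ∧
    ∀ ψ, IsTestFunction Ω ψ →
      ∫ x, u x * classicalPartial j ψ x ∂(volOn Ω) = -∫ x, v x * ψ x ∂(volOn Ω)

open Classical in
/-- The weak `j`-th partial derivative of `u` on `Ω`, unique up to null sets (zero if there is none
in `L²(Ω)`). -/
def weakPartial (Ω : Set E3) (j : Fin 3) (u : E3 → ℝ) : E3 → ℝ :=
  if h : ∃ v, HasWeakPartial Ω j u v then h.choose else 0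

/-- `u ∈ H¹(Ω)`. -/
def MemH1 (Ω : Set E3) (u : E3 → ℝ) : Prop :=
  MemLp u 2 (volOn Ω) ∧ ∀ j, ∃ v, HasWeakPartial Ω j u v

/-- `u ∈ H²(Ω)`: `u` and its first weak derivatives lie in `H¹(Ω)`. -/
def MemH2 (Ω : Set E3) (u : E3 → ℝ) : Prop :=
  MemH1 Ω u ∧ ∀ j, MemH1 Ω (weakPartial Ω j u)

/-- The norm of `L²(Ω)`. -/
def normL2 (Ω : Set E3) (u : E3 → ℝ) : ℝ := (eLpNorm u 2 (volOn Ω)).toReal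

/-- A sequence of smooth functions on `ℝ³` converges to `w` in `H¹(Ω)`. -/
def TendstoH1 (Ω : Set E3) (s : ℕ → E3 → ℝ) (w : E3 → ℝ) : Prop :=
  Tendsto (fun m => eLpNorm (s m - w) 2 (volOn Ω)) atTop (𝓝 0) ∧
    ∀ j, Tendsto (fun m => eLpNorm (classicalPartial j (s m) - weakPartial Ω j w) 2 (volOn Ω))
      atTop (𝓝 0)

/-- `u ∈ H¹₀(Ω)`: the closure of the test functions in `H¹(Ω)`. -/
def MemH10 (Ω : Set E3) (u : E3 → ℝ) : Prop :=
  MemH1 Ω u ∧ ∃ s : ℕ → E3 → ℝ, (∀ m, IsTestFunction Ω (s m)) ∧ TendstoH1 Ω s u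

/-- `g ∈ L²(∂Ω)` is the trace of `w ∈ H¹(Ω)`: some sequence of functions smooth up to the boundary
converges to `w` in `H¹(Ω)` while its restrictions to the boundary converge to `g` in `L²(∂Ω)`. -/
def IsTrace (Ω : Set E3) (w g : E3 → ℝ) : Prop :=
  MemH1 Ω w ∧ MemLp g 2 (surfaceMeasure Ω) ∧
    ∃ s : ℕ → E3 → ℝ, (∀ m, ContDiff ℝ ∞ (s m)) ∧ TendstoH1 Ω s w ∧
      Tendsto (fun m => eLpNorm (s m - g) 2 (surfaceMeasure Ω)) atTop (𝓝 0)

open Classical in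
/-- The boundary trace of `w` (zero if there is none). -/
def trace (Ω : Set E3) (w : E3 → ℝ) : E3 → ℝ :=
  if h : ∃ g, IsTrace Ω w g then h.choose else 0

/-! ### Vector fields, given by their three components -/

/-- A vector field on space, as the triple of its components. -/
abbrev Field3 := Fin 3 → E3 → ℝ

/-- `u ∈ H²(Ω)³`. -/
def FieldMemH2 (Ω : Set E3) (u : Field3) : Prop := ∀ i, MemH2 Ω (u i)

/-- `u ∈ H¹₀(Ω)³`. -/
def FieldMemH10 (Ω : Set E3) (u : Field3) : Prop := ∀ i, MemH10 Ω (u i)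

/-- The norm of `H²(Ω)³`. -/
def normH2 (Ω : Set E3) (u : Field3) : ℝ :=
  √(∑ i, (normL2 Ω (u i) ^ 2 + ∑ j, normL2 Ω (weakPartial Ω j (u i)) ^ 2
    + ∑ j, ∑ l, normL2 Ω (weakPartial Ω l (weakPartial Ω j (u i))) ^ 2))

/-- The weak curl. -/
def curl (Ω : Set E3) (u : Field3) : Field3 :=
  ![weakPartial Ω 1 (u 2) - weakPartial Ω 2 (u 1),
    weakPartial Ω 2 (u 0) - weakPartial Ω 0 (u 2),
    weakPartial Ω 0 (u 1) - weakPartial Ω 1 (u 0)]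

/-- The weak Jacobian matrix, `(∇u)ᵢⱼ = ∂ⱼuᵢ`. -/
def grad (Ω : Set E3) (u : Field3) (x : E3) : Matrix (Fin 3) (Fin 3) ℝ :=
  Matrix.of fun i j => weakPartial Ω j (u i) x

/-- The matrix field `G = ∇ω + γ (∇ω)ᵀ`, where `ω` is the curl of `u`. -/
def stressG (Ω : Set E3) (γ : ℝ) (u : Field3) (x : E3) : Matrix (Fin 3) (Fin 3) ℝ :=
  grad Ω (curl Ω u) x + γ • (grad Ω (curl Ω u) x)ᵀ

/-- The Frobenius product `A : B`. -/
def frob (A B : Matrix (Fin 3) (Fin 3) ℝ) : ℝ := ∑ i, ∑ j, A i j * B i j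

/-- The outward unit normal as a coordinate vector. -/
def nu (Ω : Set E3) (x : E3) : Fin 3 → ℝ := fun i => outwardNormal Ω x i

/-- The boundary values of a field, componentwise as traces. -/
def fieldTrace (Ω : Set E3) (u : Field3) (x : E3) : Fin 3 → ℝ := fun i => trace Ω (u i) x

/-- The normal derivative `∂ₙu = (∇u) n` on the boundary, with the trace of the gradient. -/
def normalDeriv (Ω : Set E3) (u : Field3) (x : E3) : Fin 3 → ℝ :=
  fun i => ∑ j, trace Ω (weakPartial Ω j (u i)) x * nu Ω x j

/-- The wall-eddy bilinear form
`a(u, φ) = ∫_Ω G : ∇(∇ × φ) + k ∫_∂Ω (n × ω) · ∂ₙφ`, with `ω = ∇ × u`. -/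
def form (Ω : Set E3) (γ k : ℝ) (u φ : Field3) : ℝ :=
  (∫ x, frob (stressG Ω γ u x) (grad Ω (curl Ω φ) x) ∂(volOn Ω)) +
    k * ∫ x, (nu Ω x ⨯₃ fieldTrace Ω (curl Ω u) x) ⬝ᵥ normalDeriv Ω φ x ∂(surfaceMeasure Ω)

end WallEddy

end

/-!
The boundary of `Ω` is locally the graph of a `C¹` function, and everything on the boundary is done
in such a graph chart. Flattening the graph by a shear preserves volume and gives, for functions
supported in a small ball, the divergence theorem `∫_Ω ∂ᵥF = ∫ (N · v) F dm`. Here `N` is an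
unnormalized outward normal with `N · d = 1` for a fixed transversal direction `d`, and `m` is the
area of the parameter domain carried to the boundary (`BoundaryPatch.divergence`). No area formula
is needed: Lipschitz bounds for Hausdorff measure show that `m ≤ dS ≤ K m` on the ball, which is
enough to pass between `m` and `dS` in inequalities and in almost-everywhere statements.

*Traces.* The divergence theorem for the square of a function in the direction `d` yields the trace
inequality `‖s‖_{L²(∂Ω)} ≤ C ‖s‖_{H¹(Ω)}` for smooth `s` (`exists_eLpNorm_surfaceMeasure_le`). Smooth
functions on space are dense in `H¹(Ω)`: after a partition of unity, one averages over small
balls shifted into `Ω` (`exists_smooth_tendstoH1`). So boundary values of smooth approximations are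
Cauchy in `L²(∂Ω)`; their limit is the trace, and it does not depend on the approximations.
Linearity of traces and weak derivatives, and the continuity of the trace operator, give bilinearity
and the bound `|a(u, φ)| ≤ C ‖u‖ ‖φ‖` by the Cauchy-Schwarz inequality.

*Vorticity.* Let `u ∈ H² ∩ H¹₀`. By Green's formula (`BoundaryPatch.green`) the integral of
`(Nᵢ ∂ⱼu - Nⱼ ∂ᵢu) ψ` against `m` equals `∫_Ω (∂ᵢψ ∂ⱼu - ∂ⱼψ ∂ᵢu)`, the second derivatives of `u`
cancelling because they commute. This is continuous in `u` for the `H¹` norm and vanishes for test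
functions, so it is zero, and `nᵢ ∂ⱼu = nⱼ ∂ᵢu` on the boundary (`ae_nu_mul_trace_eq`). Hence
`∂ⱼuᵢ = nⱼ (∂ₙu)ᵢ` there, and so `ω = n × ∂ₙu` (`ae_fieldTrace_curl_eq`).

*Symmetry.* The volume integrand `(∇ω + γ (∇ω)ᵀ) : ∇(∇ × φ)` is symmetric in `u` and `φ` pointwise.
On the boundary `(n × ω) · ∂ₙφ = (n × (n × ∂ₙu)) · ∂ₙφ` is symmetric too (`form_comm`).
-/

noncomputable section

namespace WallEddy

/-! ### Square-integrable functions -/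

section

section L2
variable {X : Type*} [MeasurableSpace X] {μ : Measure X}

lemma integrable_mul_of_memLp_two {f g : X → ℝ} (hf : MemLp f 2 μ) (hg : MemLp g 2 μ) :
    Integrable (fun x => f x * g x) μ :=
  hf.integrable_mul hg

lemma enorm_integral_mul_le {f g : X → ℝ} (hf : AEStronglyMeasurable f μ)
    (hg : AEStronglyMeasurable g μ) :
    ‖∫ x, f x * g x ∂μ‖ₑ ≤ eLpNorm f 2 μ * eLpNorm g 2 μ := by
  have h1 : eLpNorm (f • g) 1 μ ≤ eLpNorm f 2 μ * eLpNorm g 2 μ :=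
    eLpNorm_smul_le_mul_eLpNorm hg hf
  refine (enorm_integral_le_lintegral_enorm _).trans ?_
  rwa [eLpNorm_one_eq_lintegral_enorm] at h1

lemma abs_integral_mul_le {f g : X → ℝ} (hf : MemLp f 2 μ) (hg : MemLp g 2 μ) :
    |∫ x, f x * g x ∂μ| ≤ (eLpNorm f 2 μ).toReal * (eLpNorm g 2 μ).toReal := by
  have h3 := ENNReal.toReal_mono (ENNReal.mul_ne_top hf.2.ne hg.2.ne)
    (enorm_integral_mul_le hf.1 hg.1)
  rwa [ENNReal.toReal_mul, toReal_enorm, Real.norm_eq_abs] at h3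

/-- Integration against a fixed square-integrable function is continuous in `L²`. -/
lemma tendsto_integral_mul {h w : X → ℝ} {s : ℕ → X → ℝ} (hh : MemLp h 2 μ) (hw : MemLp w 2 μ)
    (hs : ∀ m, MemLp (s m) 2 μ) (hlim : Tendsto (fun m => eLpNorm (s m - w) 2 μ) atTop (𝓝 0)) :
    Tendsto (fun m => ∫ x, h x * s m x ∂μ) atTop (𝓝 (∫ x, h x * w x ∂μ)) := by
  rw [tendsto_iff_norm_sub_tendsto_zero]
  have hlim' : Tendsto (fun m => (eLpNorm h 2 μ).toReal * (eLpNorm (s m - w) 2 μ).toReal) atTop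
      (𝓝 0) := by
    have := (ENNReal.tendsto_toReal ENNReal.zero_ne_top).comp hlim
    simpa using this.const_mul (eLpNorm h 2 μ).toReal
  refine squeeze_zero (fun m => norm_nonneg _) (fun m => ?_) hlim'
  rw [← integral_sub (integrable_mul_of_memLp_two hh (hs m)) (integrable_mul_of_memLp_two hh hw)]
  simp_rw [← mul_sub]
  exact abs_integral_mul_le hh ((hs m).sub hw)

lemma _root_.Continuous.memLp_of_isCompact {E : Type*} [TopologicalSpace E] [MeasurableSpace E]
    [OpensMeasurableSpace E] {μ : Measure E}
    {f : E → ℝ} (hf : Continuous f) {K : Set E} (hK : IsCompact K) (hμK : ∀ᵐ x ∂μ, x ∈ K)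
    [IsFiniteMeasure μ] : MemLp f 2 μ := by
  obtain ⟨C, hC⟩ := hK.exists_bound_of_continuousOn hf.continuousOn
  exact MemLp.of_bound hf.measurable.aestronglyMeasurable C (hμK.mono hC)

/-- Multiplication by a bounded function, in `L²`. -/
lemma _root_.MeasureTheory.MemLp.bdd_mul_two {f χ : X → ℝ} (hf : MemLp f 2 μ)
    (hχ : AEStronglyMeasurable χ μ) {C : ℝ} (hC : ∀ x, |χ x| ≤ C) : MemLp (χ * f) 2 μ := by
  have h : MemLp χ ⊤ μ := memLp_top_of_bound hχ C (ae_of_all _ hC)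
  exact hf.mul h

end L2

/-! ### Weak derivatives -/

variable {Ω : Set E3} {i j : Fin 3} {u v w : E3 → ℝ}

lemma _root_.ContDiff.classicalPartial {f : E3 → ℝ} (hf : ContDiff ℝ ∞ f) :
    ContDiff ℝ ∞ (classicalPartial j f) :=
  (hf.fderiv_right (m := ∞) (by simp)).clm_apply contDiff_const

lemma continuous_classicalPartial {f : E3 → ℝ} (hf : ContDiff ℝ 1 f) :
    Continuous (classicalPartial j f) :=
  (hf.continuous_fderiv one_ne_zero).clm_apply continuous_const

lemma tsupport_classicalPartial_subset (f : E3 → ℝ) :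
    tsupport (classicalPartial j f) ⊆ tsupport f := by
  refine closure_minimal (fun x hx => ?_) isClosed_closure
  by_contra h
  have : fderiv ℝ f x = 0 := by
    by_contra h'
    exact h (support_fderiv_subset ℝ h')
  simp [classicalPartial, this] at hx

lemma classicalPartial_mul {f g : E3 → ℝ} (hf : ContDiff ℝ 1 f) (hg : ContDiff ℝ 1 g) (x : E3) :
    classicalPartial j (fun y => f y * g y) x
      = f x * classicalPartial j g x + g x * classicalPartial j f x := by
  have := fderiv_fun_mul (hf.differentiable one_ne_zero x) (hg.differentiable one_ne_zero x)
  simp [classicalPartial, this]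

lemma classicalPartial_comm {f : E3 → ℝ} (hf : ContDiff ℝ ∞ f) :
    classicalPartial i (classicalPartial j f) = classicalPartial j (classicalPartial i f) := by
  ext x
  have hd : Differentiable ℝ (fderiv ℝ f) :=
    (hf.fderiv_right (m := ∞) (by simp)).differentiable (by simp)
  have key : ∀ a b : Fin 3, classicalPartial a (classicalPartial b f) x
      = fderiv ℝ (fderiv ℝ f) x (unitVec a) (unitVec b) := by
    intro a b
    have : fderiv ℝ (fun y => fderiv ℝ f y (unitVec b)) x = _ :=
      fderiv_clm_apply (hd x) (differentiableAt_const _)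
    unfold classicalPartial
    rw [this]
    simp
  rw [key, key]
  have h2 : (2 : WithTop ℕ∞) ≤ ∞ := WithTop.coe_le_coe.2 (le_top (a := (2 : ℕ∞)))
  exact (hf.contDiffAt (x := x)).isSymmSndFDerivAt (by simpa using h2) _ _

lemma IsTestFunction.classicalPartial {ψ : E3 → ℝ} (hψ : IsTestFunction Ω ψ) :
    IsTestFunction Ω (classicalPartial j ψ) :=
  ⟨hψ.1.classicalPartial, hψ.2.1.mono' (subset_closure.trans (tsupport_classicalPartial_subset ψ)),
    (tsupport_classicalPartial_subset ψ).trans hψ.2.2⟩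

lemma IsTestFunction.mul {ψ χ : E3 → ℝ} (hψ : IsTestFunction Ω ψ) (hχ : ContDiff ℝ ∞ χ) :
    IsTestFunction Ω (fun x => χ x * ψ x) :=
  ⟨hχ.mul hψ.1, hψ.2.1.mul_left, (tsupport_mul_subset_right).trans hψ.2.2⟩

lemma _root_.HasCompactSupport.memLp_two {μ : Measure E3} [IsFiniteMeasureOnCompacts μ]
    {ψ : E3 → ℝ} (h : HasCompactSupport ψ) (hc : Continuous ψ) : MemLp ψ 2 μ :=
  hc.memLp_of_hasCompactSupport h

instance : IsFiniteMeasureOnCompacts (volOn Ω) := by unfold volOn; infer_instance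

lemma IsTestFunction.memLp {ψ : E3 → ℝ} (hψ : IsTestFunction Ω ψ) {μ : Measure E3}
    [IsFiniteMeasureOnCompacts μ] : MemLp ψ 2 μ :=
  hψ.2.1.memLp_two hψ.1.continuous

lemma hasWeakPartial_weakPartial (h : ∃ v, HasWeakPartial Ω j u v) :
    HasWeakPartial Ω j u (weakPartial Ω j u) := by
  unfold weakPartial
  rw [dif_pos h]
  exact h.choose_spec

lemma MemH1.hasWeakPartial (h : MemH1 Ω u) (j : Fin 3) :
    HasWeakPartial Ω j u (weakPartial Ω j u) :=
  hasWeakPartial_weakPartial (h.2 j)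

lemma MemH1.memLp_weakPartial (h : MemH1 Ω u) (j : Fin 3) :
    MemLp (weakPartial Ω j u) 2 (volOn Ω) :=
  (h.hasWeakPartial j).2.1

/-- The fundamental lemma of the calculus of variations on an open set. -/
lemma ae_eq_of_forall_integral_eq (hΩ : IsOpen Ω) {f g : E3 → ℝ} (hf : MemLp f 2 (volOn Ω))
    (hg : MemLp g 2 (volOn Ω))
    (h : ∀ ψ, IsTestFunction Ω ψ → ∫ x, f x * ψ x ∂(volOn Ω) = ∫ x, g x * ψ x ∂(volOn Ω)) :
    f =ᵐ[volOn Ω] g := by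
  have hloc : LocallyIntegrableOn (fun x => f x - g x) Ω (volOn Ω) :=
    ((hf.sub hg).locallyIntegrable (by norm_num)).locallyIntegrableOn Ω
  have := hΩ.ae_eq_zero_of_integral_contDiff_smul_eq_zero hloc (fun ψ h1 h2 h3 => by
    have hψ : IsTestFunction Ω ψ := ⟨h1, h2, h3⟩
    have e := h ψ hψ
    have : ∀ x, ψ x • (f x - g x) = f x * ψ x - g x * ψ x := fun x => by simp; ring
    simp_rw [this]
    rw [integral_sub (integrable_mul_of_memLp_two hf hψ.memLp)
      (integrable_mul_of_memLp_two hg hψ.memLp), e, sub_self])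
  have hmem : ∀ᵐ x ∂(volOn Ω), x ∈ Ω := ae_restrict_mem hΩ.measurableSet
  filter_upwards [this, hmem] with x h1 h2
  linarith [h1 h2]

lemma HasWeakPartial.ae_eq (hΩ : IsOpen Ω) (h1 : HasWeakPartial Ω j u v)
    (h2 : HasWeakPartial Ω j u w) : v =ᵐ[volOn Ω] w :=
  ae_eq_of_forall_integral_eq hΩ h1.2.1 h2.2.1 fun ψ hψ => by
    linarith [h1.2.2 ψ hψ, h2.2.2 ψ hψ]

lemma HasWeakPartial.weakPartial_ae_eq (hΩ : IsOpen Ω) (h : HasWeakPartial Ω j u v) :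
    weakPartial Ω j u =ᵐ[volOn Ω] v :=
  (hasWeakPartial_weakPartial ⟨v, h⟩).ae_eq hΩ h

lemma HasWeakPartial.congr {u' v' : E3 → ℝ} (h : HasWeakPartial Ω j u v)
    (hu : u =ᵐ[volOn Ω] u') (hv : v =ᵐ[volOn Ω] v') : HasWeakPartial Ω j u' v' := by
  refine ⟨h.1.ae_eq hu, h.2.1.ae_eq hv, fun ψ hψ => ?_⟩
  have e1 : ∫ x, u x * WallEddy.classicalPartial j ψ x ∂(volOn Ω)
      = ∫ x, u' x * WallEddy.classicalPartial j ψ x ∂(volOn Ω) :=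
    integral_congr_ae (hu.mono fun x hx => by simp [hx])
  have e2 : ∫ x, v x * ψ x ∂(volOn Ω) = ∫ x, v' x * ψ x ∂(volOn Ω) :=
    integral_congr_ae (hv.mono fun x hx => by simp [hx])
  rw [← e1, ← e2]
  exact h.2.2 ψ hψ

/-- A linear combination `c u + u'` has the corresponding combination of weak derivatives. -/
lemma HasWeakPartial.const_smul_add {u' v' : E3 → ℝ} (c : ℝ) (h : HasWeakPartial Ω j u v)
    (h' : HasWeakPartial Ω j u' v') : HasWeakPartial Ω j (c • u + u') (c • v + v') := by
  refine ⟨(h.1.const_smul c).add h'.1, (h.2.1.const_smul c).add h'.2.1, fun ψ hψ => ?_⟩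
  have key : ∀ f g χ : E3 → ℝ, MemLp f 2 (volOn Ω) → MemLp g 2 (volOn Ω) → IsTestFunction Ω χ →
      ∫ x, (c • f + g) x * χ x ∂(volOn Ω)
        = c * ∫ x, f x * χ x ∂(volOn Ω) + ∫ x, g x * χ x ∂(volOn Ω) := by
    intro f g χ hf hg hχ
    rw [← integral_const_mul, ← integral_add
      ((integrable_mul_of_memLp_two hf hχ.memLp).const_mul c)
      (integrable_mul_of_memLp_two hg hχ.memLp)]
    congr 1; ext x; simp; ring
  rw [key _ _ _ h.1 h'.1 hψ.classicalPartial, key _ _ _ h.2.1 h'.2.1 hψ, h.2.2 ψ hψ, h'.2.2 ψ hψ]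
  ring

lemma MemH1.const_smul_add (c : ℝ) (hu : MemH1 Ω u) (hv : MemH1 Ω v) : MemH1 Ω (c • u + v) :=
  ⟨(hu.1.const_smul c).add hv.1,
    fun j => ⟨_, (hu.hasWeakPartial j).const_smul_add c (hv.hasWeakPartial j)⟩⟩

lemma MemH1.congr (hu : MemH1 Ω u) (h : u =ᵐ[volOn Ω] v) : MemH1 Ω v :=
  ⟨hu.1.ae_eq h, fun j => ⟨_, (hu.hasWeakPartial j).congr h (ae_eq_refl _)⟩⟩

lemma MemH1.sub (hu : MemH1 Ω u) (hv : MemH1 Ω v) : MemH1 Ω (u - v) := by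
  have : u - v = (-1 : ℝ) • v + u := by ext x; simp; ring
  rw [this]; exact hv.const_smul_add _ hu

lemma weakPartial_congr (hΩ : IsOpen Ω) (hu : MemH1 Ω u) (h : u =ᵐ[volOn Ω] v) (j : Fin 3) :
    weakPartial Ω j u =ᵐ[volOn Ω] weakPartial Ω j v :=
  (((hu.hasWeakPartial j).congr h (ae_eq_refl _)).weakPartial_ae_eq hΩ).symm

lemma weakPartial_const_smul_add (hΩ : IsOpen Ω) (c : ℝ) (hu : MemH1 Ω u) (hv : MemH1 Ω v)
    (j : Fin 3) : weakPartial Ω j (c • u + v) =ᵐ[volOn Ω]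
      c • weakPartial Ω j u + weakPartial Ω j v :=
  ((hu.hasWeakPartial j).const_smul_add c (hv.hasWeakPartial j)).weakPartial_ae_eq hΩ

lemma weakPartial_sub (hΩ : IsOpen Ω) (hu : MemH1 Ω u) (hv : MemH1 Ω v) (j : Fin 3) :
    weakPartial Ω j (u - v) =ᵐ[volOn Ω] weakPartial Ω j u - weakPartial Ω j v := by
  have : u - v = (-1 : ℝ) • v + u := by ext x; simp; ring
  rw [this]
  refine (weakPartial_const_smul_add hΩ (-1) hv hu j).trans (Eventually.of_forall fun x => ?_)
  simp; ring

/-- Second weak derivatives commute. -/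
lemma MemH2.weakPartial_comm (hΩ : IsOpen Ω) (hu : MemH2 Ω u) (i j : Fin 3) :
    weakPartial Ω i (weakPartial Ω j u) =ᵐ[volOn Ω] weakPartial Ω j (weakPartial Ω i u) := by
  refine ae_eq_of_forall_integral_eq hΩ ((hu.2 j).memLp_weakPartial i)
    ((hu.2 i).memLp_weakPartial j) fun ψ hψ => ?_
  have h1 := ((hu.2 j).hasWeakPartial i).2.2 ψ hψ
  have h2 := (hu.1.hasWeakPartial j).2.2 _ (hψ.classicalPartial (j := i))
  have h3 := ((hu.2 i).hasWeakPartial j).2.2 ψ hψ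
  have h4 := (hu.1.hasWeakPartial i).2.2 _ (hψ.classicalPartial (j := j))
  rw [classicalPartial_comm hψ.1] at h2
  linarith

lemma exists_bound_of_hasCompactSupport {χ : E3 → ℝ} (hχ : HasCompactSupport χ)
    (hc : Continuous χ) : ∃ C, ∀ x, |χ x| ≤ C := by
  obtain ⟨C, hC⟩ := hχ.exists_bound_of_continuous hc
  exact ⟨C, hC⟩

/-- Leibniz rule for the product of a weakly differentiable function and a cutoff. -/
lemma HasWeakPartial.cutoff_mul {χ : E3 → ℝ} (hχ : ContDiff ℝ ∞ χ) (hc : HasCompactSupport χ)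
    (h : HasWeakPartial Ω j u v) :
    HasWeakPartial Ω j (χ * u) (χ * v + classicalPartial j χ * u) := by
  have hχ' : HasCompactSupport (classicalPartial j χ) :=
    hc.mono' (subset_closure.trans (tsupport_classicalPartial_subset χ))
  obtain ⟨C, hC⟩ := exists_bound_of_hasCompactSupport hc hχ.continuous
  obtain ⟨D, hD⟩ := exists_bound_of_hasCompactSupport hχ' hχ.classicalPartial.continuous
  have m1 : MemLp (χ * v) 2 (volOn Ω) :=
    h.2.1.bdd_mul_two hχ.continuous.aestronglyMeasurable hC
  have m2 : MemLp (classicalPartial j χ * u) 2 (volOn Ω) :=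
    h.1.bdd_mul_two hχ.classicalPartial.continuous.aestronglyMeasurable hD
  refine ⟨h.1.bdd_mul_two hχ.continuous.aestronglyMeasurable hC, m1.add m2, fun ψ hψ => ?_⟩
  have e := h.2.2 _ (hψ.mul hχ)
  have e1 : ∀ x, u x * WallEddy.classicalPartial j (fun x => χ x * ψ x) x
      = (χ * u) x * WallEddy.classicalPartial j ψ x
        + (WallEddy.classicalPartial j χ * u) x * ψ x := by
    intro x
    rw [classicalPartial_mul (hχ.of_le (by simp)) (hψ.1.of_le (by simp))]
    simp; ring
  simp_rw [e1] at e
  rw [integral_add (integrable_mul_of_memLp_two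
      (h.1.bdd_mul_two hχ.continuous.aestronglyMeasurable hC) hψ.classicalPartial.memLp)
    (integrable_mul_of_memLp_two m2 hψ.memLp)] at e
  have e2 : ∫ x, (χ * v + WallEddy.classicalPartial j χ * u) x * ψ x ∂(volOn Ω)
      = ∫ x, v x * (χ x * ψ x) ∂(volOn Ω)
        + ∫ x, (WallEddy.classicalPartial j χ * u) x * ψ x ∂(volOn Ω) := by
    rw [← integral_add (integrable_mul_of_memLp_two h.2.1 (hψ.mul hχ).memLp)
      (integrable_mul_of_memLp_two m2 hψ.memLp)]
    congr 1; ext x; simp; ring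
  rw [e2]
  linarith

end

/-! ### Mollification in `L²` -/

section

lemma eLpNorm_two_sq {X : Type*} [MeasurableSpace X] {μ : Measure X} (f : X → ℝ) :
    eLpNorm f 2 μ ^ 2 = ∫⁻ x, ‖f x‖ₑ ^ 2 ∂μ := by
  have := eLpNorm_nnreal_pow_eq_lintegral (f := f) (μ := μ) (p := 2) (by norm_num)
  simpa using this

/-- Translation is continuous in `L²`. -/
lemma exists_eLpNorm_translate_sub_le {f : E3 → ℝ} (hf : MemLp f 2 volume) {η : ENNReal}
    (hη : η ≠ 0) :
    ∃ δ > 0, ∀ z : E3, ‖z‖ < δ → eLpNorm (fun x => f (x - z) - f x) 2 volume ≤ η := by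
  let g : E3 → C(E3, E3) := fun z => ⟨fun x => x - z, by fun_prop⟩
  have hg : Continuous g := ContinuousMap.continuous_of_continuous_uncurry _
    (by simp only [Function.uncurry_def]; exact continuous_snd.sub continuous_fst)
  have hgm : ∀ z, MeasurePreserving (g z) volume volume := fun z =>
    measurePreserving_sub_right volume z
  have ht := Tendsto.compMeasurePreservingLp (p := 2) (E := ℝ)
    (tendsto_const_nhds (x := hf.toLp f) (f := 𝓝 (0 : E3))) hg.continuousAt
    hgm (hgm 0) (by norm_num)
  rw [EMetric.tendsto_nhds] at ht
  obtain ⟨δ, hδ, h⟩ := Metric.eventually_nhds_iff.1 (ht η (pos_iff_ne_zero.2 hη))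
  refine ⟨δ, hδ, fun z hz => ?_⟩
  have h1 := (h (y := z) (by simpa using hz)).le
  rw [Lp.toLp_compMeasurePreserving, Lp.toLp_compMeasurePreserving, Lp.edist_toLp_toLp] at h1
  have e : (fun x => f (x - z) - f x) = f ∘ g z - f ∘ g 0 := by
    funext x
    simp [g]
  rwa [e]

/-- Averaging against a kernel of mass one supported near the origin changes a function in `L²`
by no more than the translations in the support of the kernel do. -/
lemma eLpNorm_convolution_sub_le {f k : E3 → ℝ} (hf : MemLp f 2 volume) (hk : Continuous k)
    (hkc : HasCompactSupport k) (hk0 : ∀ x, 0 ≤ k x) (hk1 : ∫ x, k x = 1) {η : ENNReal}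
    (h : ∀ z, k z ≠ 0 → eLpNorm (fun x => f (x - z) - f x) 2 volume ≤ η) :
    eLpNorm (convolution k f (ContinuousLinearMap.lsmul ℝ ℝ) volume - f) 2 volume ≤ η := by
  wlog hfm : StronglyMeasurable f generalizing f
  · have hff := hf.1.ae_eq_mk
    have key := this (f := hf.1.mk f) (hf.ae_eq hff) (fun z hz => ?_) hf.1.stronglyMeasurable_mk
    · rw [← convolution_congr _ (ae_eq_refl k) hff] at key
      rwa [eLpNorm_congr_ae (g := convolution k f (ContinuousLinearMap.lsmul ℝ ℝ) volume
        - hf.1.mk f) ((ae_eq_refl _).sub hff)]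
    · rw [← eLpNorm_congr_ae (f := fun x => f (x - z) - f x)]
      · exact h z hz
      · exact ((measurePreserving_sub_right volume z).quasiMeasurePreserving.ae_eq_comp hff).sub hff
  -- the average is an expectation for the probability measure `ν`, so Jensen's inequality applies
  let ν : Measure E3 := volume.withDensity fun z => ENNReal.ofReal (k z)
  have hki : Integrable k := hk.integrable_of_hasCompactSupport hkc
  have hν : IsProbabilityMeasure ν := ⟨by
    rw [withDensity_apply _ MeasurableSet.univ, Measure.restrict_univ,
      ← ofReal_integral_eq_lintegral_ofReal hki (ae_of_all _ hk0), hk1, ENNReal.ofReal_one]⟩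
  have hkm : Measurable fun z => ENNReal.ofReal (k z) := hk.measurable.ennreal_ofReal
  have hF : StronglyMeasurable (fun p : E3 × E3 => f (p.1 - p.2) - f p.1) :=
    (hfm.comp_measurable (measurable_fst.sub measurable_snd)).sub (hfm.comp_measurable measurable_fst)
  have hpt : ∀ x, ‖(convolution k f (ContinuousLinearMap.lsmul ℝ ℝ) volume - f) x‖ₑ ^ 2
      ≤ ∫⁻ z, ‖f (x - z) - f x‖ₑ ^ 2 ∂ν := by
    intro x
    have hm : StronglyMeasurable (fun z => f (x - z) - f x) :=
      hF.comp_measurable (measurable_const.prodMk measurable_id)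
    have hex : Integrable (fun z => k z • f (x - z)) volume :=
      hkc.convolutionExists_left (ContinuousLinearMap.lsmul ℝ ℝ) hk
        (hf.locallyIntegrable (by norm_num)) x
    have e : (convolution k f (ContinuousLinearMap.lsmul ℝ ℝ) volume - f) x
        = ∫ z, (f (x - z) - f x) ∂ν := by
      rw [integral_withDensity_eq_integral_toReal_smul hkm (ae_of_all _ fun _ => by simp)]
      simp only [ENNReal.toReal_ofReal (hk0 _), smul_sub]
      rw [integral_sub hex (hki.smul_const (f x)), integral_smul_const, hk1, one_smul]
      rfl
    rw [e, ← eLpNorm_two_sq]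
    gcongr
    calc ‖∫ z, (f (x - z) - f x) ∂ν‖ₑ ≤ ∫⁻ z, ‖f (x - z) - f x‖ₑ ∂ν :=
          enorm_integral_le_lintegral_enorm _
      _ = eLpNorm (fun z => f (x - z) - f x) 1 ν := (eLpNorm_one_eq_lintegral_enorm).symm
      _ ≤ eLpNorm (fun z => f (x - z) - f x) 2 ν :=
          eLpNorm_le_eLpNorm_of_exponent_le (by norm_num) hm.aestronglyMeasurable
  rw [← ENNReal.pow_le_pow_left_iff two_ne_zero, eLpNorm_two_sq]
  have hFm : Measurable fun p : E3 × E3 => ‖f (p.1 - p.2) - f p.1‖ₑ ^ 2 :=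
    hF.enorm.pow_const 2
  calc ∫⁻ x, ‖(convolution k f (ContinuousLinearMap.lsmul ℝ ℝ) volume - f) x‖ₑ ^ 2
      ≤ ∫⁻ x, ∫⁻ z, ‖f (x - z) - f x‖ₑ ^ 2 ∂ν := lintegral_mono hpt
    _ = ∫⁻ z, (∫⁻ x, ‖f (x - z) - f x‖ₑ ^ 2) ∂ν :=
        lintegral_lintegral_swap (f := fun x z => ‖f (x - z) - f x‖ₑ ^ 2) hFm.aemeasurable
    _ = ∫⁻ z, ENNReal.ofReal (k z) * ∫⁻ x, ‖f (x - z) - f x‖ₑ ^ 2 := by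
        rw [lintegral_withDensity_eq_lintegral_mul _ hkm
          (hFm.lintegral_prod_left' (μ := volume))]
        rfl
    _ ≤ ∫⁻ z, ENNReal.ofReal (k z) * η ^ 2 := by
        refine lintegral_mono fun z => ?_
        by_cases hz : k z = 0
        · simp [hz]
        · have := h z hz
          rw [← eLpNorm_two_sq]
          gcongr
    _ = η ^ 2 := by
        rw [lintegral_mul_const _ hkm, ← ofReal_integral_eq_lintegral_ofReal hki
          (ae_of_all _ hk0), hk1, ENNReal.ofReal_one, one_mul]

/-- Kernels of mass one whose supports shrink to the origin form an approximate identity in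
`L²`. -/
lemma tendsto_eLpNorm_convolution_sub {f : E3 → ℝ} {k : ℕ → E3 → ℝ} {r : ℕ → ℝ}
    (hf : MemLp f 2 volume) (hk : ∀ m, Continuous (k m))
    (hkc : ∀ m, HasCompactSupport (k m)) (hk0 : ∀ m x, 0 ≤ k m x) (hk1 : ∀ m, ∫ x, k m x = 1)
    (hkr : ∀ m z, k m z ≠ 0 → ‖z‖ < r m) (hr : Tendsto r atTop (𝓝 0)) :
    Tendsto (fun m => eLpNorm
      (convolution (k m) f (ContinuousLinearMap.lsmul ℝ ℝ) volume - f) 2 volume)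
      atTop (𝓝 0) := by
  rw [ENNReal.tendsto_nhds_zero]
  intro η hη
  obtain ⟨δ, hδ, h⟩ := exists_eLpNorm_translate_sub_le hf hη.ne'
  filter_upwards [hr.eventually (gt_mem_nhds hδ)] with m hm
  exact eLpNorm_convolution_sub_le hf (hk m) (hkc m) (hk0 m) (hk1 m) fun z hz =>
    h z ((hkr m z hz).trans hm)

/-! ### Density of smooth functions -/

/-- The part of `Ω` in a ball can be moved into `Ω` along the direction `d`, by any small amount
`ε`, leaving room for balls of radius `c ε`. -/
def HasInwardShift (Ω : Set E3) (x : E3) (r : ℝ) (d : E3) (c ε₀ : ℝ) : Prop :=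
  0 < r ∧ 0 < c ∧ 0 < ε₀ ∧
    ∀ y ∈ Ω ∩ Metric.ball x r, ∀ ε ∈ Ioo 0 ε₀, Metric.ball (y + ε • d) (c * ε) ⊆ Ω

lemma convolution_lsmul_eq_mul_swap (k f : E3 → ℝ) :
    convolution k f (ContinuousLinearMap.lsmul ℝ ℝ) volume
      = convolution f k (ContinuousLinearMap.mul ℝ ℝ) volume := by
  ext x
  rw [convolution_lsmul_swap]
  simp [convolution_def, mul_comm]

lemma classicalPartial_convolution {f k : E3 → ℝ} (hf : LocallyIntegrable f volume)
    (hk : ContDiff ℝ ∞ k) (hkc : HasCompactSupport k) (j : Fin 3) (x : E3) :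
    classicalPartial j (convolution f k (ContinuousLinearMap.mul ℝ ℝ) volume) x
      = ∫ y, f y * classicalPartial j k (x - y) := by
  have h := hkc.hasFDerivAt_convolution_right (ContinuousLinearMap.mul ℝ ℝ) hf
    (hk.of_le (by simp)) x
  unfold classicalPartial
  rw [h.fderiv, convolution_precompR_apply _ hf (hkc.fderiv (𝕜 := ℝ))
    (hk.continuous_fderiv (by simp))]
  simp [convolution_def]

lemma classicalPartial_comp_const_sub {k : E3 → ℝ} (hk : Differentiable ℝ k) (x y : E3)
    (j : Fin 3) : classicalPartial j (fun y => k (x - y)) y = -classicalPartial j k (x - y) := by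
  have h : HasFDerivAt (fun y => k (x - y)) _ y :=
    (hk (x - y)).hasFDerivAt.comp y ((hasFDerivAt_id y).const_sub x)
  simp [classicalPartial, h.fderiv]

/-- Localized density: the product of an `H¹` function with a cutoff supported where `Ω` can be
shifted inwards is a limit of smooth functions. They are averages over small balls sitting
slightly inwards, so that near `Ω` only values of the function inside `Ω` enter. -/
lemma exists_smooth_tendstoH1_cutoff_mul {Ω : Set E3} (hΩ : IsOpen Ω) {x₀ d : E3} {r c ε₀ : ℝ}
    (hcone : HasInwardShift Ω x₀ r d c ε₀) {χ w : E3 → ℝ} (hχ : ContDiff ℝ ∞ χ)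
    (hχc : HasCompactSupport χ) (hχs : tsupport χ ⊆ Metric.ball x₀ r) (hw : MemH1 Ω w) :
    ∃ s : ℕ → E3 → ℝ, (∀ m, ContDiff ℝ ∞ (s m)) ∧ TendstoH1 Ω s (χ * w) := by
  obtain ⟨hr, hc, hε₀, hcone⟩ := hcone
  obtain ⟨δ, hδ, hδχ⟩ := hχc.isCompact.exists_thickening_subset_open Metric.isOpen_ball hχs
  -- shifts so small that the kernels do not leave the ball
  have hdc : 0 < ‖d‖ + c := by positivity
  let ε₁ := min (ε₀ / 2) (δ / (2 * (‖d‖ + c)))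
  have hε₁ : 0 < ε₁ := lt_min (by positivity) (by positivity)
  let ε : ℕ → ℝ := fun m => ε₁ / (m + 1)
  have hε : ∀ m, 0 < ε m := fun m => by positivity
  have hεle : ∀ m, ε m ≤ ε₁ := fun m =>
    div_le_self hε₁.le (by linarith [(Nat.cast_nonneg m : (0 : ℝ) ≤ m)])
  have hεlim : Tendsto ε atTop (𝓝 0) :=
    tendsto_const_div_atTop_nhds_zero_nat ε₁ |>.comp (tendsto_add_atTop_nat 1) |>.congr
      fun m => by simp [ε]
  have hcε : ∀ m, 0 < c * ε m := fun m => mul_pos hc (hε m)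
  -- kernels centred at `-ε d`: the value at `y` of the mollification depends on a ball around
  -- `y + ε d`
  let b : ∀ m, ContDiffBump (-(ε m • d)) := fun m =>
    ⟨c * ε m / 4, c * ε m / 2, by linarith [hcε m], by linarith [hcε m]⟩
  let k : ℕ → E3 → ℝ := fun m => (b m).normed volume
  have hk : ∀ m, ContDiff ℝ ∞ (k m) := fun m => (b m).contDiff_normed (n := ⊤)
  have hkc : ∀ m, HasCompactSupport (k m) := fun m => (b m).hasCompactSupport_normed
  have hkt : ∀ m, tsupport (k m) = Metric.closedBall (-(ε m • d)) (c * ε m / 2) :=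
    fun m => (b m).tsupport_normed_eq
  have hkr : ∀ m z, z ∈ tsupport (k m) → ‖z‖ < ε m * (‖d‖ + c) := by
    intro m z hz
    rw [hkt, mem_closedBall_iff_norm, sub_neg_eq_add] at hz
    have h1 : ‖z‖ ≤ ‖z + ε m • d‖ + ‖ε m • d‖ := by
      simpa using norm_sub_le (z + ε m • d) (ε m • d)
    rw [norm_smul, Real.norm_of_nonneg (hε m).le] at h1
    nlinarith [hcε m]
  have hεd : ∀ m, ε m * (‖d‖ + c) < δ := by
    intro m
    have h1 : ε m ≤ δ / (2 * (‖d‖ + c)) := (hεle m).trans (min_le_right _ _)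
    rw [le_div_iff₀ (by positivity)] at h1
    linarith
  have hεε₀ : ∀ m, ε m ∈ Ioo 0 ε₀ := fun m =>
    ⟨hε m, ((hεle m).trans (min_le_left _ _)).trans_lt (by linarith)⟩
  have approx : ∀ g : E3 → ℝ, MemLp g 2 (volOn Ω) →
      Tendsto (fun m => eLpNorm (convolution (Ω.indicator g) (k m)
        (ContinuousLinearMap.mul ℝ ℝ) volume - g) 2 (volOn Ω)) atTop (𝓝 0) := by
    intro g hg
    have h := tendsto_eLpNorm_convolution_sub (r := fun m => ε m * (‖d‖ + c))
      ((memLp_indicator_iff_restrict hΩ.measurableSet).2 hg)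
      (fun m => (hk m).continuous) hkc (fun m x => (b m).nonneg_normed x)
      (fun m => (b m).integral_normed) (fun m z hz => hkr m z (subset_closure hz))
      (by simpa using hεlim.mul_const (‖d‖ + c))
    refine tendsto_of_tendsto_of_tendsto_of_le_of_le tendsto_const_nhds h
      (fun _ => zero_le) fun m => ?_
    simp only
    rw [convolution_lsmul_eq_mul_swap]
    refine le_trans (le_of_eq ?_) (eLpNorm_mono_measure _ (Measure.restrict_le_self (s := Ω)))
    refine eLpNorm_congr_ae ((ae_restrict_mem hΩ.measurableSet).mono fun x hx => ?_)
    simp [hx]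
  have hloc : ∀ g : E3 → ℝ, MemLp g 2 (volOn Ω) → LocallyIntegrable (Ω.indicator g) volume :=
    fun g hg => ((memLp_indicator_iff_restrict hΩ.measurableSet).2 hg).locallyIntegrable
      (by norm_num)
  have hχw := (hw.hasWeakPartial 0).cutoff_mul hχ hχc
  refine ⟨fun m => convolution (Ω.indicator (χ * w)) (k m) (ContinuousLinearMap.mul ℝ ℝ) volume,
    fun m => (hkc m).contDiff_convolution_right (n := ⊤) _ (hloc _ hχw.1) (hk m),
    approx _ hχw.1, fun j => ?_⟩
  have hj := (hw.hasWeakPartial j).cutoff_mul hχ hχc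
  have haj := hj.weakPartial_ae_eq hΩ
  refine (approx _ hj.2.1).congr fun m => eLpNorm_congr_ae ?_
  refine Filter.EventuallyEq.sub ((ae_restrict_mem hΩ.measurableSet).mono fun x hx => ?_) haj.symm
  rw [classicalPartial_convolution (hloc _ hχw.1) (hk m) (hkc m), convolution_def]
  -- the kernel seen from a point of `Ω`, times the cutoff, is a test function
  have hsub : tsupport (fun y => k m (x - y)) ⊆ (fun y => x - y) ⁻¹' tsupport (k m) :=
    tsupport_comp_subset_preimage (k m) (f := fun y => x - y) (by fun_prop)
  have hψ : IsTestFunction Ω (fun y => χ y * k m (x - y)) := by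
    refine ⟨hχ.mul ((hk m).comp (by fun_prop)), hχc.mul_right, fun y hy => ?_⟩
    have hy1 : y ∈ tsupport χ := tsupport_mul_subset_left hy
    have hy2 : x - y ∈ tsupport (k m) := hsub (tsupport_mul_subset_right hy)
    have hxr : x ∈ Metric.ball x₀ r := by
      refine hδχ (Metric.mem_thickening_iff.2 ⟨y, hy1, ?_⟩)
      rw [dist_eq_norm]
      exact (hkr m _ hy2).trans (hεd m)
    refine hcone x ⟨hx, hxr⟩ (ε m) (hεε₀ m) ?_
    rw [hkt, mem_closedBall_iff_norm] at hy2
    rw [mem_ball_iff_norm, ← norm_neg]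
    have : -(y - (x + ε m • d)) = x - y - -(ε m • d) := by abel
    rw [this]
    linarith [hcε m]
  have e := (hw.hasWeakPartial j).2.2 _ hψ
  have hk1 : ContDiff ℝ 1 fun y => k m (x - y) := ((hk m).of_le (by simp)).comp (by fun_prop)
  simp_rw [classicalPartial_mul (hχ.of_le (by simp)) hk1,
    classicalPartial_comp_const_sub ((hk m).differentiable (by simp))] at e
  have hi : ∀ g h : E3 → ℝ, ∫ y, Ω.indicator g y * h y = ∫ y, g y * h y ∂(volOn Ω) := by
    intro g h
    rw [volOn, ← integral_indicator hΩ.measurableSet]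
    congr 1; ext y
    by_cases hy : y ∈ Ω <;> simp [hy]
  have hkm : MemLp (fun y => k m (x - y)) 2 (volOn Ω) :=
    HasCompactSupport.memLp_two ((hkc m).comp_homeomorph (Homeomorph.subLeft x)) hk1.continuous
  have hkm' : MemLp (fun y => classicalPartial j (k m) (x - y)) 2 (volOn Ω) := by
    have hcs : HasCompactSupport (classicalPartial j (k m)) :=
      (hkc m).mono' (subset_closure.trans (tsupport_classicalPartial_subset _))
    exact HasCompactSupport.memLp_two (hcs.comp_homeomorph (Homeomorph.subLeft x))
      ((hk m).classicalPartial.continuous.comp (by fun_prop))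
  simp only [ContinuousLinearMap.mul_apply']
  rw [hi, hi]
  have h3 : MemLp (classicalPartial j χ * w) 2 (volOn Ω) := by
    have hcs : HasCompactSupport (classicalPartial j χ) :=
      hχc.mono' (subset_closure.trans (tsupport_classicalPartial_subset _))
    obtain ⟨D, hD⟩ := exists_bound_of_hasCompactSupport hcs hχ.classicalPartial.continuous
    exact hw.1.bdd_mul_two hχ.classicalPartial.continuous.aestronglyMeasurable hD
  have e1 : ∫ y, (χ * weakPartial Ω j w + classicalPartial j χ * w) y * k m (x - y) ∂(volOn Ω)
      = ∫ y, weakPartial Ω j w y * (χ y * k m (x - y)) ∂(volOn Ω)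
        + ∫ y, (classicalPartial j χ * w) y * k m (x - y) ∂(volOn Ω) := by
    rw [← integral_add (integrable_mul_of_memLp_two (hw.memLp_weakPartial j) hψ.memLp)
      (integrable_mul_of_memLp_two h3 hkm)]
    congr 1; ext y; simp; ring
  have e2 : ∫ y, w y * (χ y * -classicalPartial j (k m) (x - y)
        + k m (x - y) * classicalPartial j χ y) ∂(volOn Ω)
      = ∫ y, (classicalPartial j χ * w) y * k m (x - y) ∂(volOn Ω)
        - ∫ y, (χ * w) y * classicalPartial j (k m) (x - y) ∂(volOn Ω) := by
    rw [← integral_sub (integrable_mul_of_memLp_two h3 hkm)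
      (integrable_mul_of_memLp_two hχw.1 hkm')]
    congr 1; ext y; simp; ring
  rw [e1]
  rw [e2] at e
  linarith

/-- If `Ω` can be shifted inwards near each point of its compact closure, then smooth functions
are dense in `H¹(Ω)`. -/
theorem exists_smooth_tendstoH1 {Ω : Set E3} (hΩ : IsOpen Ω) (hb : Bornology.IsBounded Ω)
    (hcone : ∀ x ∈ closure Ω, ∃ r d c ε₀, HasInwardShift Ω x r d c ε₀) {w : E3 → ℝ}
    (hw : MemH1 Ω w) :
    ∃ s : ℕ → E3 → ℝ, (∀ m, ContDiff ℝ ∞ (s m)) ∧ TendstoH1 Ω s w := by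
  choose! r d c ε₀ hcone using hcone
  have hK : IsCompact (closure Ω) := hb.isCompact_closure
  obtain ⟨t, htK, ht⟩ := hK.elim_nhds_subcover (fun x => Metric.ball x (r x)) fun x hx =>
    Metric.ball_mem_nhds x (hcone x hx).1
  obtain ⟨p, hp⟩ := SmoothPartitionOfUnity.exists_isSubordinate (modelWithCornersSelf ℝ E3)
    isClosed_closure (fun i : t => Metric.ball (i : E3) (r i)) (fun i => Metric.isOpen_ball)
    (by simpa [iUnion_subtype] using ht)
  have hχ : ∀ i, ContDiff ℝ ∞ (p i) := fun i => (p i).contMDiff.contDiff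
  have hχc : ∀ i, HasCompactSupport (p i) := fun i =>
    Metric.isCompact_of_isClosed_isBounded isClosed_closure (Metric.isBounded_ball.subset (hp i))
  choose s hs hlim using fun i : t =>
    exists_smooth_tendstoH1_cutoff_mul hΩ (hcone i (htK i i.2)) (hχ i) (hχc i) (hp i) hw
  have hsum : ∀ x ∈ Ω, ∑ i, p i x = 1 := fun x hx => by
    rw [← finsum_eq_sum_of_fintype]; exact p.sum_eq_one (subset_closure hx)
  have hw' : w =ᵐ[volOn Ω] ∑ i, (p i * w : E3 → ℝ) :=
    (ae_restrict_mem hΩ.measurableSet).mono fun x hx => by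
      rw [← Finset.sum_mul, Pi.mul_apply, Finset.sum_apply, hsum x hx, one_mul]
  have hpw : ∀ i, MemH1 Ω (p i * w) := fun i =>
    ⟨((hw.hasWeakPartial 0).cutoff_mul (hχ i) (hχc i)).1,
      fun j => ⟨_, (hw.hasWeakPartial j).cutoff_mul (hχ i) (hχc i)⟩⟩
  have key : ∀ (f : t → ℕ → E3 → ℝ) (g : t → E3 → ℝ) (F : ℕ → E3 → ℝ) (G : E3 → ℝ),
      (∀ i m, Continuous (f i m)) → (∀ i, MemLp (g i) 2 (volOn Ω)) →
      (∀ m, F m = ∑ i, f i m) → G =ᵐ[volOn Ω] ∑ i, g i →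
      (∀ i, Tendsto (fun m => eLpNorm (f i m - g i) 2 (volOn Ω)) atTop (𝓝 0)) →
      Tendsto (fun m => eLpNorm (F m - G) 2 (volOn Ω)) atTop (𝓝 0) := by
    intro f g F G hf hg hF hG hfg
    have h0 : Tendsto (fun m => ∑ i, eLpNorm (f i m - g i) 2 (volOn Ω)) atTop (𝓝 0) := by
      simpa using tendsto_finsetSum Finset.univ fun i _ => hfg i
    refine tendsto_of_tendsto_of_tendsto_of_le_of_le tendsto_const_nhds h0
      (fun _ => zero_le) fun m => ?_
    have : F m - G =ᵐ[volOn Ω] ∑ i, (f i m - g i) := by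
      rw [Finset.sum_sub_distrib, hF]
      exact (ae_eq_refl _).sub hG
    simp only
    rw [eLpNorm_congr_ae this]
    exact eLpNorm_sum_le (fun i _ => (hf i m).aestronglyMeasurable.sub (hg i).1) (by norm_num)
  refine ⟨fun m => ∑ i, s i m, fun m => ?_, ?_, fun j => ?_⟩
  · have : (∑ i, s i m) = fun x => ∑ i, s i m x := by ext; simp
    simp only [this]
    exact ContDiff.sum fun i _ => hs i m
  · exact key s _ _ w (fun i m => (hs i m).continuous) (fun i => (hpw i).1) (fun m => rfl) hw'
      fun i => (hlim i).1
  · refine key (fun i m => classicalPartial j (s i m)) _ _ _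
      (fun i m => (hs i m).classicalPartial.continuous)
      (fun i => (hpw i).memLp_weakPartial j) (fun m => ?_) ?_ fun i => (hlim i).2 j
    · ext x
      unfold classicalPartial
      rw [fderiv_sum (fun i _ => (hs i m).differentiable (by simp) x)]
      simp
    · have hfin : ∀ T : Finset t, T.Nonempty → HasWeakPartial Ω j (∑ i ∈ T, (p i * w : E3 → ℝ))
          (∑ i ∈ T, weakPartial Ω j (p i * w)) := by
        intro T hT
        induction hT using Finset.Nonempty.cons_induction with
        | singleton a => simpa using (hpw a).hasWeakPartial j
        | cons a T ha _ ih =>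
          rw [Finset.sum_cons, Finset.sum_cons]
          simpa using ((hpw a).hasWeakPartial j).const_smul_add 1 ih
      rcases (Finset.univ : Finset t).eq_empty_or_nonempty with h | h
      · -- the partition of unity is empty only if `Ω` is
        have h0 : volOn Ω = 0 := by
          rw [← ae_eq_bot, ← empty_mem_iff_bot]
          filter_upwards [ae_restrict_mem (μ := volume) hΩ.measurableSet] with x hx
          have := hsum x hx
          simp [h] at this
        simp [h0, Filter.EventuallyEq]
      · exact ((hfin _ h).congr hw'.symm (ae_eq_refl _)).weakPartial_ae_eq hΩ

end

/-! ### Graph coordinates near a boundary point -/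

section

/-- The integral of a derivative of a compactly supported function vanishes. -/
lemma integral_fderiv_apply_eq_zero {E : Type*} [NormedAddCommGroup E] [NormedSpace ℝ E]
    [FiniteDimensional ℝ E] [MeasurableSpace E] [BorelSpace E] {μ : Measure E}
    [μ.IsAddHaarMeasure] {h : E → ℝ} (hh : ContDiff ℝ 1 h) (hhc : HasCompactSupport h) (w : E) :
    ∫ p, fderiv ℝ h p w ∂μ = 0 := by
  have h1 : Integrable (fun p => fderiv ℝ h p w) μ :=
    ((hh.continuous_fderiv one_ne_zero).clm_apply continuous_const).integrable_of_hasCompactSupport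
      (hhc.fderiv_apply (𝕜 := ℝ) w)
  have := integral_mul_fderiv_eq_neg_fderiv_mul_of_integrable (μ := μ) (f := fun _ => (1 : ℝ))
    (g := h) (v := w) (by simp) (by simpa using h1)
    (by simpa using hh.continuous.integrable_of_hasCompactSupport hhc) (by simp)
    fun p _ => hh.differentiable one_ne_zero p
  simpa using this

/-- The Euclidean plane, in which the parameters of a boundary patch lie. -/
abbrev E2 := EuclideanSpace ℝ (Fin 2)

/-- Orthonormal coordinates `(p, t)` of space in which `Ω` is, near `x`, the region above the
graph of the `C¹` function `g`. -/
structure GraphChart (Ω : Set E3) (x : E3) where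
  /-- the change of coordinates -/
  A : (E2 × ℝ) ≃L[ℝ] E3
  inner_A : ∀ p q : E2 × ℝ, inner ℝ (A p) (A q) = inner ℝ p.1 q.1 + p.2 * q.2
  measurePreserving_A : MeasurePreserving A volume volume
  /-- the function whose graph is the boundary -/
  g : E2 → ℝ
  contDiff_g : ContDiff ℝ 1 g
  /-- the radius of the chart -/
  r : ℝ
  r_pos : 0 < r
  mem_iff : ∀ y ∈ Metric.ball x r, (y ∈ Ω ↔ g (A.symm y).1 < (A.symm y).2)

/-- Splitting off the last coordinate of space. -/
def splitLast : E3 ≃ₗᵢ[ℝ] WithLp 2 (E2 × ℝ) where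
  toFun y := WithLp.toLp 2 (!₂[y 0, y 1], y 2)
  invFun z := !₂[z.fst 0, z.fst 1, z.snd]
  map_add' y z := by
    refine WithLp.ofLp_injective 2 (Prod.ext ?_ (by simp))
    ext i; fin_cases i <;> simp
  map_smul' c y := by
    refine WithLp.ofLp_injective 2 (Prod.ext ?_ (by simp))
    ext i; fin_cases i <;> simp
  left_inv y := by ext i; fin_cases i <;> simp
  right_inv z := by
    refine WithLp.ofLp_injective 2 (Prod.ext ?_ (by simp))
    ext i; fin_cases i <;> simp
  norm_map' y := by
    simp [WithLp.prod_norm_eq_of_L2, EuclideanSpace.norm_eq, Fin.sum_univ_three,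
      Fin.sum_univ_two, Real.sq_sqrt, add_nonneg, sq_nonneg]

lemma HasC2Boundary.exists_graphChart {Ω : Set E3} (hΩ : HasC2Boundary Ω) {x : E3}
    (hx : x ∈ frontier Ω) : Nonempty (GraphChart Ω x) := by
  obtain ⟨e, r, g, hr, hg, h⟩ := hΩ x hx
  let L : WithLp 2 (E2 × ℝ) ≃ₗᵢ[ℝ] E3 := splitLast.symm.trans e.symm
  exact ⟨{
    A := (WithLp.prodContinuousLinearEquiv 2 ℝ E2 ℝ).symm.trans L.toContinuousLinearEquiv
    inner_A := fun p q => by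
      simp [mul_comm]
    measurePreserving_A := by
      have h1 : MeasurePreserving (WithLp.toLp 2 : E2 × ℝ → WithLp 2 (E2 × ℝ)) volume volume :=
        WithLp.volume_preserving_toLp _ _
      exact L.measurePreserving.comp h1
    g := g
    contDiff_g := hg.of_le (by norm_num)
    r := r
    r_pos := hr
    mem_iff := h }⟩

namespace GraphChart
variable {Ω : Set E3} {x : E3} (G : GraphChart Ω x)

/-- The parametrization of the boundary by the graph. -/
def param (p : E2) : E3 := G.A (p, G.g p)

/-- The parameter of a point. -/
def proj (y : E3) : E2 := (G.A.symm y).1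

/-- The normal vector of the graph, pointing out of `Ω`, scaled so that its component along the
axis of the graph is one. -/
def normal (y : E3) : E3 := G.A (gradient G.g (G.proj y), -1)

/-- The downward direction of the chart. -/
def down : E3 := G.A (0, -1)

@[simp] lemma proj_param (p : E2) : G.proj (G.param p) = p := by simp [proj, param]

lemma continuous_proj : Continuous G.proj :=
  continuous_fst.comp G.A.symm.continuous

lemma continuous_param : Continuous G.param :=
  G.A.continuous.comp (continuous_id.prodMk G.contDiff_g.continuous)

lemma continuous_normal : Continuous G.normal := by
  refine G.A.continuous.comp (Continuous.prodMk ?_ continuous_const)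
  have : Continuous (gradient G.g) :=
    (InnerProductSpace.toDual ℝ E2).symm.continuous.comp
      (G.contDiff_g.continuous_fderiv one_ne_zero)
  exact this.comp G.continuous_proj

lemma inner_normal (y : E3) (w : E2) (σ : ℝ) :
    inner ℝ (G.normal y) (G.A (w, σ)) = fderiv ℝ G.g (G.proj y) w - σ := by
  rw [normal, G.inner_A]
  simp only [neg_mul, one_mul, ← sub_eq_add_neg, inner_gradient_left]

lemma inner_normal_down (y : E3) : inner ℝ (G.normal y) G.down = 1 := by
  rw [down, inner_normal]; simp

lemma norm_A_sq (p : E2 × ℝ) : ‖G.A p‖ ^ 2 = ‖p.1‖ ^ 2 + p.2 ^ 2 := by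
  rw [← real_inner_self_eq_norm_sq, G.inner_A, real_inner_self_eq_norm_sq, sq p.2]

lemma norm_fst_le (p : E2 × ℝ) : ‖p.1‖ ≤ ‖G.A p‖ := by
  refine le_of_sq_le_sq ?_ (norm_nonneg _)
  rw [G.norm_A_sq]; nlinarith [sq_nonneg p.2]

lemma abs_snd_le (p : E2 × ℝ) : |p.2| ≤ ‖G.A p‖ := by
  refine le_of_sq_le_sq ?_ (norm_nonneg _)
  rw [G.norm_A_sq, sq_abs]; nlinarith [sq_nonneg ‖p.1‖]

lemma norm_A_le (p : E2 × ℝ) : ‖G.A p‖ ≤ ‖p.1‖ + |p.2| := by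
  refine le_of_sq_le_sq ?_ (by positivity)
  rw [G.norm_A_sq, ← sq_abs p.2]; nlinarith [norm_nonneg p.1, abs_nonneg p.2]

lemma dist_proj_le (y z : E3) : dist (G.proj y) (G.proj z) ≤ dist y z := by
  have := G.norm_fst_le (G.A.symm (y - z))
  rw [dist_eq_norm, dist_eq_norm]
  simpa [proj] using this

/-- The map `(p, t) ↦ A (p, g p + t)`, which flattens the boundary. -/
def flatten : (E2 × ℝ) ≃ₜ E3 :=
  Homeomorph.trans
    { toFun := fun p => (p.1, G.g p.1 + p.2)
      invFun := fun p => (p.1, p.2 - G.g p.1)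
      left_inv := fun p => by simp
      right_inv := fun p => by simp
      continuous_toFun := by have := G.contDiff_g.continuous; fun_prop
      continuous_invFun := by have := G.contDiff_g.continuous; fun_prop }
    G.A.toHomeomorph

lemma flatten_apply (p : E2 × ℝ) : G.flatten p = G.A (p.1, G.g p.1 + p.2) := rfl

lemma measurePreserving_flatten : MeasurePreserving G.flatten volume volume := by
  refine G.measurePreserving_A.comp ?_
  refine (MeasurePreserving.id volume).skew_product (g := fun p t => G.g p + t) ?_
    (ae_of_all _ fun p => map_add_left_eq_self volume (G.g p))
  have := G.contDiff_g.continuous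
  exact Continuous.measurable (by simp only [Function.uncurry_def]; fun_prop)

lemma hasFDerivAt_flatten (p : E2 × ℝ) : HasFDerivAt G.flatten
    ((G.A : (E2 × ℝ) →L[ℝ] E3) ∘L
      ((ContinuousLinearMap.fst ℝ E2 ℝ).prod
        ((fderiv ℝ G.g p.1) ∘L (ContinuousLinearMap.fst ℝ E2 ℝ)
          + ContinuousLinearMap.snd ℝ E2 ℝ))) p := by
  have hg : HasFDerivAt G.g _ p.1 := (G.contDiff_g.differentiable one_ne_zero p.1).hasFDerivAt
  exact G.A.hasFDerivAt.comp p
    (hasFDerivAt_fst.prodMk ((hg.comp p hasFDerivAt_fst).add hasFDerivAt_snd))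

lemma contDiff_flatten : ContDiff ℝ 1 G.flatten :=
  G.A.contDiff.comp (contDiff_fst.prodMk ((G.contDiff_g.comp contDiff_fst).add contDiff_snd))

/-- The divergence theorem above a graph, for functions of compact support. -/
lemma integral_fderiv_epigraph {F : E3 → ℝ} (hF : ContDiff ℝ 1 F) (hFc : HasCompactSupport F)
    (v : E3) :
    ∫ y in {y | G.g (G.A.symm y).1 < (G.A.symm y).2}, fderiv ℝ F y v
      = ∫ p, inner ℝ (G.normal (G.param p)) v * F (G.param p) := by
  obtain ⟨⟨w, σ⟩, rfl⟩ := G.A.surjective v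
  -- in flattened coordinates the domain is a half-space
  let H : E2 × ℝ → ℝ := F ∘ G.flatten
  have hH : ContDiff ℝ 1 H := hF.comp G.contDiff_flatten
  have hHc : HasCompactSupport H := hFc.comp_homeomorph G.flatten
  have hHw : ∀ u : E2 × ℝ, Continuous fun p => fderiv ℝ H p u := fun u =>
    (hH.continuous_fderiv one_ne_zero).clm_apply continuous_const
  have hHwc : ∀ u : E2 × ℝ, HasCompactSupport fun p => fderiv ℝ H p u := fun u =>
    hHc.fderiv_apply (𝕜 := ℝ) u
  have hpre : G.flatten ⁻¹' {y | G.g (G.A.symm y).1 < (G.A.symm y).2} = univ ×ˢ Ioi 0 := by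
    ext p; simp [flatten_apply]
  have hder : ∀ p : E2 × ℝ, fderiv ℝ F (G.flatten p) (G.A (w, σ))
      = fderiv ℝ H p (w, 0) + (σ - fderiv ℝ G.g p.1 w) * fderiv ℝ H p (0, 1) := by
    intro p
    have hc : HasFDerivAt H _ p :=
      ((hF.differentiable one_ne_zero (G.flatten p)).hasFDerivAt).comp p (G.hasFDerivAt_flatten p)
    rw [hc.fderiv]
    simp only [ContinuousLinearMap.comp_apply, ContinuousLinearMap.prod_apply,
      add_apply, ContinuousLinearMap.coe_fst', ContinuousLinearMap.coe_snd',
      ContinuousLinearEquiv.coe_coe, map_zero, add_zero, zero_add]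
    rw [← smul_eq_mul, ← map_smul, ← map_add, ← map_smul, ← map_add]
    simp
  have hcg : Continuous fun p : E2 => fderiv ℝ G.g p w :=
    (G.contDiff_g.continuous_fderiv one_ne_zero).clm_apply continuous_const
  let μ : Measure (E2 × ℝ) := (volume : Measure E2).prod (volume.restrict (Ioi 0))
  have hμ : μ = (volume : Measure (E2 × ℝ)).restrict (univ ×ˢ Ioi 0) := by
    rw [Measure.volume_eq_prod, ← Measure.prod_restrict, Measure.restrict_univ]
  have hi1 : Integrable (fun p => fderiv ℝ H p (w, 0)) μ := by
    rw [hμ]; exact ((hHw _).integrable_of_hasCompactSupport (hHwc _)).integrableOn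
  have hi2 : Integrable (fun p : E2 × ℝ => (σ - fderiv ℝ G.g p.1 w) * fderiv ℝ H p (0, 1)) μ := by
    rw [hμ]
    refine Integrable.integrableOn (Continuous.integrable_of_hasCompactSupport ?_
      (hHwc _).mul_left)
    exact (continuous_const.sub (hcg.comp continuous_fst)).mul (hHw _)
  -- the horizontal derivative integrates to zero over each horizontal slice
  have hI1 : ∫ p, fderiv ℝ H p (w, 0) ∂μ = 0 := by
    rw [integral_prod_symm _ hi1]
    refine integral_eq_zero_of_ae (ae_of_all _ fun t => ?_)
    let h : E2 → ℝ := fun p => H (p, t)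
    have hh : ContDiff ℝ 1 h := hH.comp (contDiff_id.prodMk contDiff_const)
    have hhc : HasCompactSupport h := by
      have : IsClosedEmbedding fun p : E2 => (p, t) :=
        ⟨isEmbedding_prodMkLeft t, by
          have : range (fun p : E2 => (p, t)) = univ ×ˢ {t} := by ext; simp [Prod.ext_iff, eq_comm]
          rw [this]; exact isClosed_univ.prod isClosed_singleton⟩
      exact hHc.comp_isClosedEmbedding this
    have hd : ∀ p, fderiv ℝ H (p, t) (w, 0) = fderiv ℝ h p w := by
      intro p
      have hc : HasFDerivAt h _ p := HasFDerivAt.comp (g := H) (f := fun q => (q, t)) p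
        (hH.differentiable one_ne_zero (p, t)).hasFDerivAt (hasFDerivAt_prodMk_left p t)
      rw [hc.fderiv]; simp
    simp only [hd]
    exact integral_fderiv_apply_eq_zero hh hhc w
  -- the vertical derivative integrates over each ray to minus the value at its endpoint
  have hI2 : ∫ p : E2 × ℝ, (σ - fderiv ℝ G.g p.1 w) * fderiv ℝ H p (0, 1) ∂μ
      = ∫ p, inner ℝ (G.normal (G.param p)) (G.A (w, σ)) * F (G.param p) := by
    rw [integral_prod _ hi2]
    congr 1; ext p
    simp only
    rw [integral_const_mul, G.inner_normal, proj_param]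
    let h : ℝ → ℝ := fun t => H (p, t)
    have hh : ContDiff ℝ 1 h := hH.comp (contDiff_const.prodMk contDiff_id)
    have hhc : HasCompactSupport h := by
      have : IsClosedEmbedding fun t : ℝ => (p, t) :=
        ⟨isEmbedding_prodMkRight p, by
          have : range (fun t : ℝ => (p, t)) = {p} ×ˢ univ := by ext; simp [Prod.ext_iff, eq_comm]
          rw [this]; exact isClosed_singleton.prod isClosed_univ⟩
      exact hHc.comp_isClosedEmbedding this
    have hd : ∀ t, fderiv ℝ H (p, t) (0, 1) = deriv h t := by
      intro t
      have hc : HasFDerivAt h _ t := HasFDerivAt.comp (g := H) (f := fun q => (p, q)) t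
        (hH.differentiable one_ne_zero (p, t)).hasFDerivAt (hasFDerivAt_prodMk_right p t)
      rw [← fderiv_apply_one_eq_deriv, hc.fderiv]; simp
    simp only [hd]
    rw [hhc.integral_Ioi_deriv_eq hh]
    simp only [h, H, Function.comp_apply, flatten_apply, param, add_zero]
    ring
  rw [← G.measurePreserving_flatten.setIntegral_preimage_emb G.flatten.measurableEmbedding, hpre,
    ← hμ]
  simp_rw [hder]
  rw [integral_add hi1 hi2, hI1, hI2, zero_add]

end GraphChart

end

/-! ### Boundary patches -/

section

lemma _root_.LipschitzOnWith.euclideanHausdorffMeasure_image_le {X Y : Type*} [MetricSpace X]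
    [MeasurableSpace X] [BorelSpace X] [MetricSpace Y] [MeasurableSpace Y] [BorelSpace Y]
    {K : NNReal} {f : X → Y} {s : Set X} (h : LipschitzOnWith K f s) (d : ℕ) :
    μHE[d] (f '' s) ≤ (K : ENNReal) ^ d * μHE[d] s := by
  have := h.hausdorffMeasure_image_le (d := d) (Nat.cast_nonneg d)
  rw [Measure.euclideanHausdorffMeasure_def, Measure.euclideanHausdorffMeasure_def,
    Measure.smul_apply, Measure.smul_apply, ENNReal.smul_def, ENNReal.smul_def, smul_eq_mul,
    smul_eq_mul, mul_left_comm]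
  rw [ENNReal.rpow_natCast] at this
  gcongr

/-- The description of `Ω` near a boundary point used for traces: a field `N` that is a positive
multiple of the outward normal, and a measure `m` comparable to surface measure, with which the
divergence theorem holds for functions supported in a small ball. -/
structure BoundaryPatch (Ω : Set E3) (x : E3) where
  /-- the radius of the patch -/
  r : ℝ
  r_pos : 0 < r
  /-- the area of the parameter domain, as a measure on the boundary -/
  m : Measure E3
  finite_m : IsFiniteMeasure m
  /-- the normal field -/
  N : E3 → E3
  continuous_N : Continuous N
  /-- a direction transversal to the boundary -/
  d : E3
  inner_N : ∀ y, inner ℝ (N y) d = 1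
  m_le : m ≤ surfaceMeasure Ω
  /-- the ratio of surface measure to the area of the parameter domain, at most -/
  K : NNReal
  le_m : (surfaceMeasure Ω).restrict (Metric.ball x r) ≤ K • m
  isNormal : ∀ y ∈ frontier Ω ∩ Metric.ball x r, IsOutwardUnitNormal Ω y (‖N y‖⁻¹ • N y)
  divergence : ∀ F : E3 → ℝ, ContDiff ℝ 1 F → HasCompactSupport F → tsupport F ⊆ Metric.ball x r →
    ∀ v, ∫ y, fderiv ℝ F y v ∂(volOn Ω) = ∫ y, inner ℝ (N y) v * F y ∂m

namespace GraphChart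
variable {Ω : Set E3} {x : E3} (G : GraphChart Ω x)

lemma proj_mem_ball {y : E3} (hy : y ∈ Metric.ball x G.r) :
    G.proj y ∈ Metric.ball (G.proj x) G.r :=
  (G.dist_proj_le y x).trans_lt hy

lemma exists_lipschitzOnWith : ∃ L : NNReal, LipschitzOnWith L G.g
    (Metric.ball (G.proj x) G.r) := by
  obtain ⟨C, hC⟩ := (isCompact_closedBall (G.proj x) G.r).exists_bound_of_continuousOn
    (G.contDiff_g.continuous_fderiv one_ne_zero).continuousOn
  refine ⟨C.toNNReal, (convex_ball _ _).lipschitzOnWith_of_nnnorm_fderiv_le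
    (fun p _ => G.contDiff_g.differentiable one_ne_zero p) fun p hp => ?_⟩
  rw [← NNReal.coe_le_coe, coe_nnnorm]
  exact (hC p (Metric.ball_subset_closedBall hp)).trans (Real.le_coe_toNNReal C)

lemma param_proj_of_mem_frontier (hΩ : IsOpen Ω) {y : E3} (hy : y ∈ frontier Ω)
    (hyr : y ∈ Metric.ball x G.r) : G.param (G.proj y) = y := by
  have h1 : y ∉ Ω := fun h => by
    rw [hΩ.frontier_eq] at hy; exact hy.2 h
  have h2 : (G.A.symm y).2 ≤ G.g (G.A.symm y).1 := not_lt.1 fun h => h1 ((G.mem_iff y hyr).2 h)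
  have h3 : G.g (G.A.symm y).1 ≤ (G.A.symm y).2 := by
    by_contra h
    rw [not_le] at h
    have hc1 : Continuous fun z => (G.A.symm z).2 := continuous_snd.comp G.A.symm.continuous
    have hc2 : Continuous fun z => G.g (G.A.symm z).1 :=
      G.contDiff_g.continuous.comp G.continuous_proj
    have hev : ∀ᶠ z in 𝓝 y, (G.A.symm z).2 < G.g (G.A.symm z).1 ∧ z ∈ Metric.ball x G.r :=
      ((isOpen_lt hc1 hc2).eventually_mem h).and (Metric.isOpen_ball.eventually_mem hyr)
    obtain ⟨z, hz, hz1, hz2⟩ := ((mem_closure_iff_frequently.1 hy.1).and_eventually hev).exists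
    exact hz1.not_gt ((G.mem_iff z hz2).1 hz)
  rw [param, proj, le_antisymm h3 h2, Prod.mk.eta, G.A.apply_symm_apply]

lemma param_mem_frontier (hΩ : IsOpen Ω) {p : E2} (hp : G.param p ∈ Metric.ball x G.r) :
    G.param p ∈ frontier Ω := by
  rw [hΩ.frontier_eq]
  refine ⟨?_, fun h => ?_⟩
  · have hc : Continuous fun t : ℝ => G.A (p, G.g p + t) := by fun_prop
    have ht : Tendsto (fun t : ℝ => G.A (p, G.g p + t)) (𝓝[>] 0) (𝓝 (G.param p)) := by
      have := hc.tendsto 0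
      simp only [add_zero] at this
      exact this.mono_left nhdsWithin_le_nhds
    refine mem_closure_of_tendsto ht ?_
    filter_upwards [ht.eventually (Metric.isOpen_ball.mem_nhds hp), self_mem_nhdsWithin]
      with t h1 h2
    rw [G.mem_iff _ h1]
    simpa using h2
  · have := (G.mem_iff _ hp).1 h
    simp [param] at this

lemma normal_ne_zero (y : E3) : G.normal y ≠ 0 := fun h => by
  have := G.inner_normal_down y
  simp [h] at this

lemma isOutwardUnitNormal (hΩ : IsOpen Ω) {y : E3} (hy : y ∈ frontier Ω)
    (hyr : y ∈ Metric.ball x G.r) :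
    IsOutwardUnitNormal Ω y (‖G.normal y‖⁻¹ • G.normal y) := by
  have hn : 0 < ‖G.normal y‖ := norm_pos_iff.2 (G.normal_ne_zero y)
  have hpar := G.param_proj_of_mem_frontier hΩ hy hyr
  -- the height of the graph above a straight path, and its initial slope
  have key : ∀ v : E3, Tendsto (fun t : ℝ => t⁻¹ * (G.g (G.A.symm (y + t • v)).1
      - (G.A.symm (y + t • v)).2)) (𝓝[>] 0) (𝓝 (inner ℝ (G.normal y) v)) := by
    intro v
    obtain ⟨⟨w, σ⟩, rfl⟩ := G.A.surjective v
    have h1 : HasDerivAt (fun t : ℝ => G.proj y + t • w) w 0 := by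
      simpa using ((hasDerivAt_id (0 : ℝ)).smul_const w).const_add (G.proj y)
    have h2 : HasDerivAt (fun t : ℝ => G.g (G.proj y + t • w)) (fderiv ℝ G.g (G.proj y) w) 0 := by
      have hg : HasFDerivAt G.g (fderiv ℝ G.g (G.proj y)) (G.proj y + (0 : ℝ) • w) := by
        simpa using (G.contDiff_g.differentiable one_ne_zero (G.proj y)).hasFDerivAt
      exact hg.comp_hasDerivAt 0 h1
    have h3 : HasDerivAt (fun t : ℝ => G.g (G.proj y + t • w) - (G.g (G.proj y) + t * σ))
        (fderiv ℝ G.g (G.proj y) w - σ) 0 :=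
      h2.sub (by simpa using ((hasDerivAt_id (0 : ℝ)).mul_const σ).const_add (G.g (G.proj y)))
    have h4 := h3.tendsto_slope_zero_right
    rw [G.inner_normal]
    refine h4.congr fun t => ?_
    have e : G.A.symm (y + t • G.A (w, σ)) = (G.proj y + t • w, G.g (G.proj y) + t * σ) := by
      conv_lhs => rw [← hpar, param, ← map_smul, ← map_add, G.A.symm_apply_apply]
      simp
    rw [e]
    simp
  have hball : ∀ v : E3, ∀ᶠ t : ℝ in 𝓝[>] 0, y + t • v ∈ Metric.ball x G.r := by
    intro v
    have hc : Continuous fun t : ℝ => y + t • v := by fun_prop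
    have := hc.tendsto 0
    simp only [zero_smul, add_zero] at this
    exact (this.mono_left nhdsWithin_le_nhds).eventually (Metric.isOpen_ball.mem_nhds hyr)
  refine ⟨?_, fun v hv => ?_, fun v hv => ?_⟩
  · rw [norm_smul, norm_inv, norm_norm, inv_mul_cancel₀ hn.ne']
  · rw [real_inner_smul_left] at hv
    have hv' : inner ℝ (G.normal y) v < 0 := by
      by_contra h; exact hv.not_ge (mul_nonneg (inv_nonneg.2 hn.le) (not_lt.1 h))
    filter_upwards [(key v).eventually (gt_mem_nhds hv'), hball v, self_mem_nhdsWithin]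
      with t h1 h2 h3
    rw [G.mem_iff _ h2]
    by_contra h
    exact h1.not_ge (mul_nonneg (inv_nonneg.2 (mem_Ioi.1 h3).le) (by linarith [not_lt.1 h]))
  · rw [real_inner_smul_left] at hv
    have hv' : 0 < inner ℝ (G.normal y) v := by
      by_contra h
      exact hv.not_ge (mul_nonpos_of_nonneg_of_nonpos (inv_nonneg.2 hn.le) (not_lt.1 h))
    filter_upwards [(key v).eventually (lt_mem_nhds hv'), hball v, self_mem_nhdsWithin]
      with t h1 h2 h3
    rw [G.mem_iff _ h2]
    intro h
    exact h1.not_ge (mul_nonpos_of_nonneg_of_nonpos (inv_nonneg.2 (mem_Ioi.1 h3).le)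
      (by linarith))

/-- Above a graph of Lipschitz constant `L`, moving up by `ε` leaves room for balls of radius
`ε / (L + 1)`. -/
lemma exists_hasInwardShift (G : GraphChart Ω x) :
    ∃ r d c ε₀, HasInwardShift Ω x r d c ε₀ := by
  obtain ⟨L, hL⟩ := G.exists_lipschitzOnWith
  have hr := G.r_pos
  have hL0 : (0 : ℝ) ≤ L := L.2
  refine ⟨G.r / 2, G.A (0, 1), 1 / (L + 1), G.r / 4, by positivity, by positivity, by positivity,
    ?_⟩
  rintro y ⟨hyΩ, hyr⟩ ε ⟨hε, hεr⟩ z hz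
  have hc : 1 / ((L : ℝ) + 1) * ε ≤ ε := by
    rw [div_mul_eq_mul_div, one_mul]
    exact div_le_self hε.le (by linarith)
  obtain ⟨q, hq⟩ : ∃ q, G.A q = z - (y + ε • G.A (0, 1)) := G.A.surjective _
  have hzq : z = y + ε • G.A (0, 1) + G.A q := by rw [hq]; abel
  have hqn : ‖G.A q‖ < 1 / ((L : ℝ) + 1) * ε := by rw [hq, ← dist_eq_norm]; exact hz
  have hn1 : ‖G.A (0, 1)‖ ≤ 1 := by simpa using G.norm_A_le (0, 1)
  have hyr' : dist y x < G.r / 2 := hyr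
  have hzx : z ∈ Metric.ball x G.r := by
    have h1 : dist z y ≤ ε + ε := by
      rw [hzq, dist_eq_norm, show y + ε • G.A (0, 1) + G.A q - y = ε • G.A (0, 1) + G.A q by abel]
      refine (norm_add_le _ _).trans (add_le_add ?_ (hqn.le.trans hc))
      rw [norm_smul, Real.norm_of_nonneg hε.le]
      nlinarith
    rw [Metric.mem_ball]
    linarith [dist_triangle z y x]
  have hyx : y ∈ Metric.ball x G.r := by
    rw [Metric.mem_ball]; linarith
  have hy := (G.mem_iff y hyx).1 hyΩ
  have e : G.A.symm z = ((G.A.symm y).1 + q.1, (G.A.symm y).2 + ε + q.2) := by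
    rw [hzq, map_add, map_add, map_smul, G.A.symm_apply_apply, G.A.symm_apply_apply]
    ext <;> simp
  rw [G.mem_iff z hzx, e]
  have h1 : dist (G.g ((G.A.symm y).1 + q.1)) (G.g (G.A.symm y).1) ≤ L * ‖q.1‖ := by
    have hz1 := G.proj_mem_ball hzx
    simp only [proj, e] at hz1
    have hy1 := G.proj_mem_ball hyx
    simpa [proj] using hL.dist_le_mul _ hz1 _ hy1
  have h2 := G.norm_fst_le q
  have h3 := G.abs_snd_le q
  have h4 : (L : ℝ) * ‖q.1‖ + |q.2| < ε := by
    have : ((L : ℝ) + 1) * ‖G.A q‖ < ε := by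
      calc ((L : ℝ) + 1) * ‖G.A q‖ < (L + 1) * (1 / ((L : ℝ) + 1) * ε) := by gcongr
        _ = ε := by field_simp
    nlinarith [mul_le_mul_of_nonneg_left h2 hL0]
  rw [Real.dist_eq] at h1
  have h5 := (abs_le.1 h1).2
  have h6 := (abs_le.1 h3).1
  have h7 := neg_abs_le q.2
  simp only
  linarith

/-- The measure on the boundary given by the area in the parameter domain. -/
def patchMeasure : Measure E3 :=
  (volume.restrict (G.param ⁻¹' Metric.ball x G.r)).map G.param

lemma preimage_ball_subset :
    G.param ⁻¹' Metric.ball x G.r ⊆ Metric.ball (G.proj x) G.r := fun p hp => by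
  simpa using G.proj_mem_ball hp

lemma isOpen_preimage_ball : IsOpen (G.param ⁻¹' Metric.ball x G.r) :=
  Metric.isOpen_ball.preimage G.continuous_param

lemma patchMeasure_apply {B : Set E3} (hB : MeasurableSet B) :
    G.patchMeasure B = μHE[2] (G.param ⁻¹' B ∩ G.param ⁻¹' Metric.ball x G.r) := by
  rw [patchMeasure, Measure.map_apply G.continuous_param.measurable hB,
    Measure.restrict_apply (G.continuous_param.measurable hB),
    EuclideanSpace.euclideanHausdorffMeasure_eq_volume]

/-- The projection to the parameter plane does not increase area. -/
lemma patchMeasure_le (hΩ : IsOpen Ω) : G.patchMeasure ≤ surfaceMeasure Ω := by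
  refine Measure.le_iff.2 fun B hB => ?_
  have hP : LipschitzWith 1 G.proj := LipschitzWith.of_dist_le_mul fun y z => by
    simpa using G.dist_proj_le y z
  rw [G.patchMeasure_apply hB, surfaceMeasure, Measure.restrict_apply hB]
  have h1 := (hP.lipschitzOnWith (s := B ∩ frontier Ω)).euclideanHausdorffMeasure_image_le 2
  simp only [ENNReal.coe_one, one_pow, one_mul] at h1
  refine (measure_mono ?_).trans h1
  rintro p ⟨hp1, hp2⟩
  exact ⟨G.param p, ⟨hp1, G.param_mem_frontier hΩ hp2⟩, by simp⟩

/-- The parametrization increases area by at most the square of its Lipschitz constant. -/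
lemma exists_surfaceMeasure_le (hΩ : IsOpen Ω) : ∃ K : NNReal,
    (surfaceMeasure Ω).restrict (Metric.ball x G.r) ≤ K • G.patchMeasure := by
  obtain ⟨L, hL⟩ := G.exists_lipschitzOnWith
  have hP : LipschitzOnWith (1 + L) G.param (G.param ⁻¹' Metric.ball x G.r) := by
    refine LipschitzOnWith.of_dist_le_mul fun p hp q hq => ?_
    have h1 := hL.dist_le_mul _ (G.preimage_ball_subset hp) _ (G.preimage_ball_subset hq)
    rw [param, param, dist_eq_norm, ← map_sub]
    refine (G.norm_A_le _).trans ?_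
    rw [Real.dist_eq] at h1
    simp only [Prod.mk_sub_mk, NNReal.coe_add, NNReal.coe_one]
    rw [← dist_eq_norm]
    linarith
  refine ⟨(1 + L) ^ 2, Measure.le_iff.2 fun B hB => ?_⟩
  rw [Measure.smul_apply, G.patchMeasure_apply hB, surfaceMeasure,
    Measure.restrict_restrict Metric.isOpen_ball.measurableSet, Measure.restrict_apply hB,
    ENNReal.smul_def, smul_eq_mul]
  have h1 := (hP.mono (inter_subset_right (s := G.param ⁻¹' B))).euclideanHausdorffMeasure_image_le 2
  push_cast at h1 ⊢
  refine (measure_mono ?_).trans h1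
  rintro y ⟨hyB, hyr, hyf⟩
  have e := G.param_proj_of_mem_frontier hΩ hyf hyr
  exact ⟨G.proj y, ⟨by simpa [e] using hyB, by simpa [e] using hyr⟩, e⟩

lemma divergence (hΩ : IsOpen Ω) {F : E3 → ℝ} (hF : ContDiff ℝ 1 F) (hFc : HasCompactSupport F)
    (hFs : tsupport F ⊆ Metric.ball x G.r) (v : E3) :
    ∫ y, fderiv ℝ F y v ∂(volOn Ω) = ∫ y, inner ℝ (G.normal y) v * F y ∂G.patchMeasure := by
  have hF0 : ∀ y ∉ Metric.ball x G.r, F y = 0 := fun y hy =>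
    image_eq_zero_of_notMem_tsupport fun h => hy (hFs h)
  have hF0' : ∀ y ∉ Metric.ball x G.r, fderiv ℝ F y = 0 := fun y hy => by
    by_contra h
    exact hy (hFs (support_fderiv_subset ℝ h))
  have hm : MeasurableSet {y | G.g (G.A.symm y).1 < (G.A.symm y).2} :=
    (isOpen_lt (G.contDiff_g.continuous.comp G.continuous_proj)
      (continuous_snd.comp G.A.symm.continuous)).measurableSet
  have e1 : ∫ y, fderiv ℝ F y v ∂(volOn Ω)
      = ∫ y in {y | G.g (G.A.symm y).1 < (G.A.symm y).2}, fderiv ℝ F y v := by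
    rw [volOn, ← integral_indicator hΩ.measurableSet, ← integral_indicator hm]
    congr 1; ext y
    by_cases hy : y ∈ Metric.ball x G.r
    · simp [indicator, G.mem_iff y hy]
    · simp [indicator, hF0' y hy]
  have hc : Continuous fun y => inner ℝ (G.normal y) v * F y :=
    (G.continuous_normal.inner continuous_const).mul hF.continuous
  rw [e1, G.integral_fderiv_epigraph hF hFc, patchMeasure,
    integral_map G.continuous_param.aemeasurable hc.aestronglyMeasurable,
    ← integral_indicator G.isOpen_preimage_ball.measurableSet]
  congr 1; ext p
  by_cases hp : p ∈ G.param ⁻¹' Metric.ball x G.r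
  · rw [indicator_of_mem hp]
  · rw [indicator_of_notMem hp, hF0 _ hp, mul_zero]

/-- The boundary patch of a graph chart. -/
def patch (hΩ : IsOpen Ω) : BoundaryPatch Ω x where
  r := G.r
  r_pos := G.r_pos
  m := G.patchMeasure
  finite_m := by
    have : IsFiniteMeasure (volume.restrict (G.param ⁻¹' Metric.ball x G.r)) :=
      ⟨by
        rw [Measure.restrict_apply_univ]
        exact (measure_mono G.preimage_ball_subset).trans_lt measure_ball_lt_top⟩
    unfold patchMeasure
    infer_instance
  N := G.normal
  continuous_N := G.continuous_normal
  d := G.down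
  inner_N := G.inner_normal_down
  m_le := G.patchMeasure_le hΩ
  K := (G.exists_surfaceMeasure_le hΩ).choose
  le_m := (G.exists_surfaceMeasure_le hΩ).choose_spec
  isNormal := fun _ hy => G.isOutwardUnitNormal hΩ hy.1 hy.2
  divergence := fun _ hF hFc hFs v => G.divergence hΩ hF hFc hFs v

end GraphChart

lemma HasC2Boundary.exists_patch {Ω : Set E3} (hΩo : IsOpen Ω) (hΩ : HasC2Boundary Ω) {x : E3}
    (hx : x ∈ frontier Ω) : Nonempty (BoundaryPatch Ω x) :=
  (hΩ.exists_graphChart hx).map fun G => G.patch hΩo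

lemma HasC2Boundary.exists_hasInwardShift {Ω : Set E3} (hΩo : IsOpen Ω) (hΩ : HasC2Boundary Ω)
    {x : E3} (hx : x ∈ closure Ω) : ∃ r d c ε₀, HasInwardShift Ω x r d c ε₀ := by
  by_cases h : x ∈ Ω
  · obtain ⟨R, hR, hball⟩ := Metric.isOpen_iff.1 hΩo x h
    refine ⟨R / 2, 0, 1, R / 2, by positivity, one_pos, by positivity, ?_⟩
    rintro y ⟨-, hy⟩ ε ⟨-, hε⟩ z hz
    refine hball ?_
    simp only [smul_zero, add_zero, one_mul, Metric.mem_ball] at hz hy ⊢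
    linarith [dist_triangle z y x]
  · obtain ⟨G⟩ := hΩ.exists_graphChart (x := x) (by rw [hΩo.frontier_eq]; exact ⟨hx, h⟩)
    exact G.exists_hasInwardShift

end

/-! ### The outward normal -/

section

variable {Ω : Set E3}

lemma IsOutwardUnitNormal.eq {x n n' : E3} (h : IsOutwardUnitNormal Ω x n)
    (h' : IsOutwardUnitNormal Ω x n') : n = n' := by
  by_contra hne
  -- the direction `n' - n` would have to lead both into and out of the set
  have hlt : inner ℝ n n' < 1 := inner_lt_one_iff_real_of_norm_eq_one h.1 h'.1 |>.2 hne
  have e1 : inner ℝ n (n' - n) < 0 := by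
    rw [inner_sub_right, real_inner_self_eq_norm_sq, h.1]; linarith
  have e2 : 0 < inner ℝ n' (n' - n) := by
    rw [inner_sub_right, real_inner_self_eq_norm_sq, h'.1, real_inner_comm]; linarith
  obtain ⟨t, h1, h2⟩ := ((h.2.1 _ e1).and (h'.2.2 _ e2)).exists
  exact h2 h1

lemma IsOutwardUnitNormal.outwardNormal_eq {x n : E3} (h : IsOutwardUnitNormal Ω x n) :
    outwardNormal Ω x = n := by
  have hex : ∃ n, IsOutwardUnitNormal Ω x n := ⟨n, h⟩
  rw [outwardNormal, dif_pos hex]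
  exact hex.choose_spec.eq h

lemma norm_outwardNormal_le (x : E3) : ‖outwardNormal Ω x‖ ≤ 1 := by
  unfold outwardNormal
  split_ifs with h
  · exact h.choose_spec.1.le
  · simp

lemma abs_nu_le (x : E3) (i : Fin 3) : |nu Ω x i| ≤ 1 :=
  (PiLp.norm_apply_le (outwardNormal Ω x) i).trans (norm_outwardNormal_le x)

namespace BoundaryPatch
variable {x : E3} (P : BoundaryPatch Ω x)

lemma N_ne_zero (y : E3) : P.N y ≠ 0 := fun h => by
  have := P.inner_N y
  simp [h] at this

lemma outwardNormal_eq {y : E3} (hy : y ∈ frontier Ω) (hyr : y ∈ Metric.ball x P.r) :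
    outwardNormal Ω y = ‖P.N y‖⁻¹ • P.N y :=
  (P.isNormal y ⟨hy, hyr⟩).outwardNormal_eq

end BoundaryPatch

/-- The boundary is covered by boundary patches. -/
def HasPatches (Ω : Set E3) : Prop := ∀ x ∈ frontier Ω, Nonempty (BoundaryPatch Ω x)

lemma continuousOn_outwardNormal (hP : HasPatches Ω) :
    ContinuousOn (outwardNormal Ω) (frontier Ω) := by
  intro x hx
  obtain ⟨P⟩ := hP x hx
  have hc : ContinuousAt (fun y => ‖P.N y‖⁻¹ • P.N y) x :=
    (P.continuous_N.norm.continuousAt.inv₀ (norm_ne_zero_iff.2 (P.N_ne_zero x))).smul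
      P.continuous_N.continuousAt
  have hball : ∀ᶠ y in 𝓝[frontier Ω] x, y ∈ Metric.ball x P.r :=
    nhdsWithin_le_nhds (Metric.ball_mem_nhds x P.r_pos)
  refine hc.continuousWithinAt.congr_of_eventuallyEq ?_
    (P.outwardNormal_eq hx (Metric.mem_ball_self P.r_pos))
  filter_upwards [hball, self_mem_nhdsWithin] with y h1 h2
  exact P.outwardNormal_eq h2 h1

lemma aestronglyMeasurable_nu (hP : HasPatches Ω) (i : Fin 3) :
    AEStronglyMeasurable (fun x => nu Ω x i) (surfaceMeasure Ω) := by
  have h : ContinuousOn (fun x => nu Ω x i) (frontier Ω) :=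
    (EuclideanSpace.proj (𝕜 := ℝ) i).continuous.comp_continuousOn (continuousOn_outwardNormal hP)
  exact h.aestronglyMeasurable isClosed_frontier.measurableSet

/-- A property that holds almost everywhere near each boundary point holds almost everywhere on
the boundary. -/
lemma ae_surfaceMeasure_of_locally {p : E3 → Prop}
    (h : ∀ x ∈ frontier Ω, ∃ r > 0, ∀ᵐ y ∂(surfaceMeasure Ω).restrict (Metric.ball x r), p y) :
    ∀ᵐ y ∂surfaceMeasure Ω, p y := by
  have hfr : ∀ᵐ y ∂surfaceMeasure Ω, y ∈ frontier Ω :=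
    ae_restrict_mem isClosed_frontier.measurableSet
  have h0 : surfaceMeasure Ω {y | y ∈ frontier Ω ∧ ¬ p y} = 0 := by
    refine measure_null_of_locally_null _ fun x hx => ?_
    obtain ⟨r, hr, hp⟩ := h x hx.1
    rw [ae_restrict_iff' Metric.isOpen_ball.measurableSet] at hp
    refine ⟨{y | ¬ (y ∈ Metric.ball x r → p y)}, ?_, hp⟩
    filter_upwards [nhdsWithin_le_nhds (Metric.ball_mem_nhds x hr), self_mem_nhdsWithin]
      with y h1 h2
    exact fun hh => h2.2 (hh h1)
  filter_upwards [hfr, measure_eq_zero_iff_ae_notMem.1 h0] with y h1 h2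
  by_contra h3
  exact h2 ⟨h1, h3⟩

/-! ### The trace inequality -/

/-- The `H¹` norm of a function `f` with gradient `p`, extended-valued. -/
def sobolevNorm (Ω : Set E3) (f : E3 → ℝ) (p : Fin 3 → E3 → ℝ) : ENNReal :=
  eLpNorm f 2 (volOn Ω) + ∑ j, eLpNorm (p j) 2 (volOn Ω)

lemma eLpNorm_le_sobolevNorm (f : E3 → ℝ) (p : Fin 3 → E3 → ℝ) :
    eLpNorm f 2 (volOn Ω) ≤ sobolevNorm Ω f p :=
  le_self_add

lemma eLpNorm_le_sobolevNorm' (f : E3 → ℝ) (p : Fin 3 → E3 → ℝ) (j : Fin 3) :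
    eLpNorm (p j) 2 (volOn Ω) ≤ sobolevNorm Ω f p :=
  (Finset.single_le_sum (f := fun j => eLpNorm (p j) 2 (volOn Ω)) (fun _ _ => zero_le)
    (Finset.mem_univ j)).trans le_add_self

lemma sobolevNorm_sub_le {f g : E3 → ℝ} {p q : Fin 3 → E3 → ℝ}
    (hf : AEStronglyMeasurable f (volOn Ω)) (hg : AEStronglyMeasurable g (volOn Ω))
    (hp : ∀ j, AEStronglyMeasurable (p j) (volOn Ω))
    (hq : ∀ j, AEStronglyMeasurable (q j) (volOn Ω)) :
    sobolevNorm Ω (f - g) (p - q) ≤ sobolevNorm Ω f p + sobolevNorm Ω g q := by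
  unfold sobolevNorm
  rw [add_add_add_comm, ← Finset.sum_add_distrib]
  exact add_le_add (eLpNorm_sub_le hf hg (by norm_num))
    (Finset.sum_le_sum fun j _ => eLpNorm_sub_le (hp j) (hq j) (by norm_num))

lemma sobolevNorm_add_le {f g : E3 → ℝ} {p q : Fin 3 → E3 → ℝ}
    (hf : AEStronglyMeasurable f (volOn Ω)) (hg : AEStronglyMeasurable g (volOn Ω))
    (hp : ∀ j, AEStronglyMeasurable (p j) (volOn Ω))
    (hq : ∀ j, AEStronglyMeasurable (q j) (volOn Ω)) :
    sobolevNorm Ω (f + g) (p + q) ≤ sobolevNorm Ω f p + sobolevNorm Ω g q := by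
  unfold sobolevNorm
  rw [add_add_add_comm, ← Finset.sum_add_distrib]
  exact add_le_add (eLpNorm_add_le hf hg (by norm_num))
    (Finset.sum_le_sum fun j _ => eLpNorm_add_le (hp j) (hq j) (by norm_num))

/-- The classical gradient. -/
def classicalGrad (f : E3 → ℝ) : Fin 3 → E3 → ℝ := fun j => classicalPartial j f

lemma fderiv_apply_eq_sum (f : E3 → ℝ) (y d : E3) :
    fderiv ℝ f y d = ∑ j, d j * classicalPartial j f y := by
  have h : d = ∑ j, d j • unitVec j := by
    ext i
    fin_cases i <;> simp [unitVec, Fin.sum_univ_three]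
  conv_lhs => rw [h]
  simp [classicalPartial]

lemma memLp_volOn_of_continuous (hb : Bornology.IsBounded Ω) (hΩ : IsOpen Ω) {f : E3 → ℝ}
    (hf : Continuous f) : MemLp f 2 (volOn Ω) := by
  have : IsFiniteMeasure (volOn Ω) := ⟨by
    rw [volOn, Measure.restrict_apply_univ]; exact hb.measure_lt_top⟩
  exact hf.memLp_of_isCompact hb.isCompact_closure
    ((ae_restrict_mem hΩ.measurableSet).mono fun x hx => subset_closure hx)

lemma sobolevNorm_classicalGrad_ne_top (hb : Bornology.IsBounded Ω) (hΩ : IsOpen Ω) {f : E3 → ℝ}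
    (hf : ContDiff ℝ 1 f) : sobolevNorm Ω f (classicalGrad f) ≠ ⊤ := by
  refine ENNReal.add_ne_top.2 ⟨(memLp_volOn_of_continuous hb hΩ hf.continuous).2.ne,
    ENNReal.sum_ne_top.2 fun j _ => ?_⟩
  exact (memLp_volOn_of_continuous hb hΩ (continuous_classicalPartial hf)).2.ne

lemma eLpNorm_fderiv_mul_le {χ s : E3 → ℝ} (hχ : ContDiff ℝ 1 χ) (hs : ContDiff ℝ 1 s)
    (hχ1 : ∀ y, |χ y| ≤ 1) {d : E3} {D : NNReal} (hD : ∀ y, ‖fderiv ℝ χ y d‖ ≤ D) :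
    eLpNorm (fun y => fderiv ℝ (fun y => χ y * s y) y d) 2 (volOn Ω)
      ≤ (D + ‖d‖₊ : NNReal) * sobolevNorm Ω s (classicalGrad s) := by
  have hder : ∀ y, fderiv ℝ (fun y => χ y * s y) y d
      = χ y * fderiv ℝ s y d + s y * fderiv ℝ χ y d := by
    intro y
    have := fderiv_fun_mul (hχ.differentiable one_ne_zero y) (hs.differentiable one_ne_zero y)
    simp [this]
  let F : Fin 3 → E3 → ℝ := fun j y => ‖d‖ * ‖classicalPartial j s y‖
  have hcF : ∀ j, Continuous (F j) := fun j =>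
    continuous_const.mul (continuous_classicalPartial hs).norm
  have h1 : ∀ y, ‖fderiv ℝ (fun y => χ y * s y) y d‖ ≤ ((fun y => D * ‖s y‖) + ∑ j, F j) y := by
    intro y
    rw [hder, add_comm]
    refine (norm_add_le _ _).trans (add_le_add ?_ ?_)
    · rw [norm_mul, mul_comm]
      exact mul_le_mul_of_nonneg_right (hD y) (norm_nonneg _)
    · rw [norm_mul, Finset.sum_apply, fderiv_apply_eq_sum]
      refine (mul_le_of_le_one_left (norm_nonneg _) (hχ1 y)).trans
        ((norm_sum_le _ _).trans (Finset.sum_le_sum fun j _ => ?_))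
      rw [norm_mul]
      exact mul_le_mul_of_nonneg_right (PiLp.norm_apply_le d j) (norm_nonneg _)
  have h2 : ∀ (c : NNReal) (h : E3 → ℝ),
      eLpNorm (fun y => (c : ℝ) * ‖h y‖) 2 (volOn Ω) = c * eLpNorm h 2 (volOn Ω) := by
    intro c h
    have := eLpNorm_const_smul (μ := volOn Ω) (p := 2) (c : ℝ) (fun y => ‖h y‖)
    rw [eLpNorm_norm, Real.enorm_of_nonneg (NNReal.coe_nonneg c), ENNReal.ofReal_coe_nnreal] at this
    exact this
  calc eLpNorm (fun y => fderiv ℝ (fun y => χ y * s y) y d) 2 (volOn Ω)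
      ≤ eLpNorm ((fun y => D * ‖s y‖) + ∑ j, F j) 2 (volOn Ω) := eLpNorm_mono_real h1
    _ ≤ eLpNorm (fun y => D * ‖s y‖) 2 (volOn Ω) + ∑ j, eLpNorm (F j) 2 (volOn Ω) := by
        refine (eLpNorm_add_le (continuous_const.mul hs.continuous.norm).aestronglyMeasurable
          (Finset.aestronglyMeasurable_sum _ fun j _ => (hcF j).aestronglyMeasurable)
          (by norm_num)).trans (add_le_add le_rfl ?_)
        exact eLpNorm_sum_le (fun j _ => (hcF j).aestronglyMeasurable) (by norm_num)
    _ = D * eLpNorm s 2 (volOn Ω)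
        + ‖d‖₊ * ∑ j, eLpNorm (classicalPartial j s) 2 (volOn Ω) := by
        rw [h2, Finset.mul_sum]
        congr 1
        exact Finset.sum_congr rfl fun j _ => h2 ‖d‖₊ _
    _ ≤ (D + ‖d‖₊ : NNReal) * sobolevNorm Ω s (classicalGrad s) := by
        rw [ENNReal.coe_add, add_mul]
        exact add_le_add (mul_le_mul_right (eLpNorm_le_sobolevNorm _ _) _)
          (mul_le_mul_right le_add_self _)

/-- The divergence theorem for the square of a function, in the direction transversal to the
boundary. -/
lemma BoundaryPatch.lintegral_sq_le {x : E3} (P : BoundaryPatch Ω x) {f : E3 → ℝ}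
    (hf : ContDiff ℝ 1 f) (hfc : HasCompactSupport f) (hft : tsupport f ⊆ Metric.ball x P.r) :
    ∫⁻ y, ‖f y‖ₑ ^ 2 ∂P.m
      ≤ 2 * (eLpNorm f 2 (volOn Ω) * eLpNorm (fun y => fderiv ℝ f y P.d) 2 (volOn Ω)) := by
  have := P.finite_m
  have hfc2 : HasCompactSupport fun y => f y ^ 2 := by
    simp_rw [sq]; exact hfc.mul_right
  have hft2 : (tsupport fun y => f y ^ 2) ⊆ Metric.ball x P.r := by
    simp_rw [sq]; exact tsupport_mul_subset_left.trans hft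
  have hcd : Continuous fun y => fderiv ℝ f y P.d :=
    (hf.continuous_fderiv one_ne_zero).clm_apply continuous_const
  have hdiv : ∫ y, f y ^ 2 ∂P.m = 2 * ∫ y, f y * fderiv ℝ f y P.d ∂(volOn Ω) := by
    have h1 := P.divergence (fun y => f y ^ 2) (hf.pow 2) hfc2 hft2 P.d
    simp only [P.inner_N, one_mul] at h1
    rw [← h1, ← integral_const_mul]
    congr 1; ext y
    rw [fderiv_fun_pow 2 (hf.differentiable one_ne_zero y)]
    simp; ring
  have hi : Integrable (fun y => f y ^ 2) P.m :=
    (hf.continuous.pow 2).integrable_of_hasCompactSupport hfc2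
  have e : ∫⁻ y, ‖f y‖ₑ ^ 2 ∂P.m = ENNReal.ofReal (∫ y, f y ^ 2 ∂P.m) := by
    rw [ofReal_integral_eq_lintegral_ofReal hi (ae_of_all _ fun y => sq_nonneg _)]
    refine lintegral_congr fun y => ?_
    rw [← enorm_pow, Real.enorm_of_nonneg (sq_nonneg _)]
  rw [e, hdiv]
  calc ENNReal.ofReal (2 * ∫ y, f y * fderiv ℝ f y P.d ∂(volOn Ω))
      ≤ ‖2 * ∫ y, f y * fderiv ℝ f y P.d ∂(volOn Ω)‖ₑ := Real.ofReal_le_enorm _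
    _ = 2 * ‖∫ y, f y * fderiv ℝ f y P.d ∂(volOn Ω)‖ₑ := by
        rw [enorm_mul, Real.enorm_of_nonneg zero_le_two]; simp
    _ ≤ 2 * (eLpNorm f 2 (volOn Ω) * eLpNorm (fun y => fderiv ℝ f y P.d) 2 (volOn Ω)) :=
        mul_le_mul_right (enorm_integral_mul_le hf.continuous.aestronglyMeasurable
          hcd.aestronglyMeasurable) _

/-- The trace inequality on a boundary patch. -/
lemma BoundaryPatch.exists_lintegral_le {x : E3} (P : BoundaryPatch Ω x) :
    ∃ C : NNReal, ∀ s : E3 → ℝ, ContDiff ℝ 1 s →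
      ∫⁻ y in Metric.ball x (P.r / 2), ‖s y‖ₑ ^ 2 ∂(surfaceMeasure Ω)
        ≤ C * sobolevNorm Ω s (classicalGrad s) ^ 2 := by
  have hr := P.r_pos
  let χ : ContDiffBump x := ⟨P.r / 2, 3 * P.r / 4, by linarith, by linarith⟩
  have hχ : ContDiff ℝ 1 χ := χ.contDiff
  have hχt : tsupport χ ⊆ Metric.ball x P.r := by
    rw [χ.tsupport_eq]; exact Metric.closedBall_subset_ball (by simp [χ]; linarith)
  have hχ1 : ∀ y, |χ y| ≤ 1 := fun y => by rw [abs_of_nonneg χ.nonneg]; exact χ.le_one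
  obtain ⟨D, hD⟩ := (χ.hasCompactSupport.fderiv_apply (𝕜 := ℝ) P.d).exists_bound_of_continuous
    ((hχ.continuous_fderiv one_ne_zero).clm_apply continuous_const)
  lift D to NNReal using (norm_nonneg _).trans (hD x)
  let C₁ : NNReal := D + ‖P.d‖₊
  refine ⟨P.K * (2 * C₁), fun s hs => ?_⟩
  let f : E3 → ℝ := fun y => χ y * s y
  have hf : ContDiff ℝ 1 f := hχ.mul hs
  have hfc : HasCompactSupport f := χ.hasCompactSupport.mul_right
  have hft : tsupport f ⊆ Metric.ball x P.r := tsupport_mul_subset_left.trans hχt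
  have hfle : eLpNorm f 2 (volOn Ω) ≤ sobolevNorm Ω s (classicalGrad s) := by
    refine (eLpNorm_mono fun y => ?_).trans (eLpNorm_le_sobolevNorm _ _)
    simp only [f, norm_mul, Real.norm_eq_abs]
    exact mul_le_of_le_one_left (abs_nonneg _) (hχ1 y)
  have hdle : eLpNorm (fun y => fderiv ℝ f y P.d) 2 (volOn Ω)
      ≤ C₁ * sobolevNorm Ω s (classicalGrad s) :=
    eLpNorm_fderiv_mul_le hχ hs hχ1 hD
  have hint : ∫⁻ y, ‖f y‖ₑ ^ 2 ∂P.m ≤ 2 * C₁ * sobolevNorm Ω s (classicalGrad s) ^ 2 :=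
    calc ∫⁻ y, ‖f y‖ₑ ^ 2 ∂P.m
        ≤ 2 * (eLpNorm f 2 (volOn Ω) * eLpNorm (fun y => fderiv ℝ f y P.d) 2 (volOn Ω)) :=
          P.lintegral_sq_le hf hfc hft
      _ ≤ 2 * (sobolevNorm Ω s (classicalGrad s) * (C₁ * sobolevNorm Ω s (classicalGrad s))) :=
          mul_le_mul_right (mul_le_mul' hfle hdle) _
      _ = 2 * C₁ * sobolevNorm Ω s (classicalGrad s) ^ 2 := by ring
  have hsub : Metric.ball x (P.r / 2) ⊆ Metric.ball x P.r :=
    Metric.ball_subset_ball (by linarith)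
  calc ∫⁻ y in Metric.ball x (P.r / 2), ‖s y‖ₑ ^ 2 ∂(surfaceMeasure Ω)
      = ∫⁻ y in Metric.ball x (P.r / 2), ‖f y‖ₑ ^ 2 ∂(surfaceMeasure Ω) := by
        refine setLIntegral_congr_fun Metric.isOpen_ball.measurableSet fun y hy => ?_
        have : χ y = 1 := χ.one_of_mem_closedBall (Metric.ball_subset_closedBall hy)
        simp [f, this]
    _ ≤ ∫⁻ y in Metric.ball x P.r, ‖f y‖ₑ ^ 2 ∂(surfaceMeasure Ω) :=
        lintegral_mono_set hsub
    _ ≤ ∫⁻ y, ‖f y‖ₑ ^ 2 ∂(P.K • P.m) := lintegral_mono' P.le_m le_rfl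
    _ = P.K * ∫⁻ y, ‖f y‖ₑ ^ 2 ∂P.m := lintegral_smul_measure _ _
    _ ≤ P.K * (2 * C₁ * sobolevNorm Ω s (classicalGrad s) ^ 2) := mul_le_mul_right hint _
    _ = _ := by push_cast; ring

/-- The trace inequality: the `L²` norm on the boundary is controlled by the `H¹` norm. -/
theorem exists_eLpNorm_surfaceMeasure_le (hb : Bornology.IsBounded Ω) (hP : HasPatches Ω) :
    ∃ C : NNReal, ∀ s : E3 → ℝ, ContDiff ℝ 1 s →
      eLpNorm s 2 (surfaceMeasure Ω) ≤ C * sobolevNorm Ω s (classicalGrad s) := by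
  have hex : ∀ x ∈ frontier Ω, ∃ r > 0, ∃ C : NNReal, ∀ s : E3 → ℝ, ContDiff ℝ 1 s →
      ∫⁻ y in Metric.ball x r, ‖s y‖ₑ ^ 2 ∂(surfaceMeasure Ω)
        ≤ C * sobolevNorm Ω s (classicalGrad s) ^ 2 := fun x hx => by
    obtain ⟨P⟩ := hP x hx
    exact ⟨P.r / 2, half_pos P.r_pos, P.exists_lintegral_le⟩
  choose! r hr C hC using hex
  have hK : IsCompact (frontier Ω) :=
    hb.isCompact_closure.of_isClosed_subset isClosed_frontier frontier_subset_closure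
  obtain ⟨t, htK, ht⟩ := hK.elim_nhds_subcover (fun x => Metric.ball x (r x)) fun x hx =>
    Metric.ball_mem_nhds x (hr x hx)
  refine ⟨∑ x ∈ t, C x + 1, fun s hs => ?_⟩
  have h1 : ∫⁻ y, ‖s y‖ₑ ^ 2 ∂(surfaceMeasure Ω)
      ≤ (∑ x ∈ t, C x : NNReal) * sobolevNorm Ω s (classicalGrad s) ^ 2 := by
    calc ∫⁻ y, ‖s y‖ₑ ^ 2 ∂(surfaceMeasure Ω)
        = ∫⁻ y in ⋃ x : t, Metric.ball (x : E3) (r x), ‖s y‖ₑ ^ 2 ∂(surfaceMeasure Ω) := by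
          conv_lhs => rw [← Measure.restrict_univ (μ := surfaceMeasure Ω)]
          refine setLIntegral_congr ?_
          filter_upwards [ae_restrict_mem (μ := μHE[2]) isClosed_frontier.measurableSet] with y hy
          exact propext ⟨fun _ => show y ∈ ⋃ x : t, Metric.ball (x : E3) (r x) by
            simpa using ht hy, fun _ => mem_univ y⟩
      _ ≤ ∑ x ∈ t, ∫⁻ y in Metric.ball x (r x), ‖s y‖ₑ ^ 2 ∂(surfaceMeasure Ω) := by
          refine (lintegral_iUnion_le _ _).trans_eq ?_
          rw [tsum_fintype]
          exact Finset.sum_coe_sort t fun x =>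
            ∫⁻ y in Metric.ball x (r x), ‖s y‖ₑ ^ 2 ∂(surfaceMeasure Ω)
      _ ≤ ∑ x ∈ t, C x * sobolevNorm Ω s (classicalGrad s) ^ 2 :=
          Finset.sum_le_sum fun x hx => hC x (htK x hx) s hs
      _ = _ := by rw [← Finset.sum_mul]; push_cast; rfl
  rw [← ENNReal.pow_le_pow_left_iff two_ne_zero, eLpNorm_two_sq, mul_pow]
  refine h1.trans ?_
  gcongr
  rw [← ENNReal.coe_pow, ENNReal.coe_le_coe]
  nlinarith [(∑ x ∈ t, C x).2, sq_nonneg ((∑ x ∈ t, C x : NNReal))]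

end

/-! ### Existence and uniqueness of traces -/

section

variable {Ω : Set E3} {u v w g g' : E3 → ℝ}

/-- The weak gradient of a function. -/
def weakGrad (Ω : Set E3) (w : E3 → ℝ) : Fin 3 → E3 → ℝ := fun j => weakPartial Ω j w

lemma TendstoH1.sobolevNorm {s : ℕ → E3 → ℝ} (h : TendstoH1 Ω s w) :
    Tendsto (fun m => sobolevNorm Ω (s m - w) (classicalGrad (s m) - weakGrad Ω w)) atTop (𝓝 0) := by
  have := h.1.add (tendsto_finsetSum Finset.univ fun j _ => h.2 j)
  simpa [WallEddy.sobolevNorm, classicalGrad, weakGrad] using this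

lemma memLp_surfaceMeasure (hb : Bornology.IsBounded Ω) (hΩ : IsOpen Ω) (hP : HasPatches Ω)
    {f : E3 → ℝ} (hf : ContDiff ℝ 1 f) : MemLp f 2 (surfaceMeasure Ω) := by
  obtain ⟨C, hC⟩ := exists_eLpNorm_surfaceMeasure_le hb hP
  exact ⟨hf.continuous.aestronglyMeasurable, (hC f hf).trans_lt
    (ENNReal.mul_lt_top ENNReal.coe_lt_top
      (sobolevNorm_classicalGrad_ne_top hb hΩ hf).lt_top)⟩

lemma classicalGrad_sub {s t : E3 → ℝ} (hs : ContDiff ℝ 1 s) (ht : ContDiff ℝ 1 t) :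
    classicalGrad (s - t) = classicalGrad s - classicalGrad t := by
  ext j x
  simp only [classicalGrad, classicalPartial, Pi.sub_apply]
  rw [fderiv_sub (hs.differentiable one_ne_zero x) (ht.differentiable one_ne_zero x)]
  simp

lemma aestronglyMeasurable_classicalGrad {s : E3 → ℝ} (hs : ContDiff ℝ 1 s) {μ : Measure E3}
    (j : Fin 3) : AEStronglyMeasurable (classicalGrad s j) μ :=
  (continuous_classicalPartial hs).aestronglyMeasurable

/-- Approximations in `H¹` of the same function are close to each other in `L²` of the boundary. -/
lemma exists_eLpNorm_sub_le (hb : Bornology.IsBounded Ω) (hP : HasPatches Ω) :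
    ∃ C : NNReal, ∀ (w s t : E3 → ℝ), MemH1 Ω w → ContDiff ℝ 1 s → ContDiff ℝ 1 t →
      eLpNorm (s - t) 2 (surfaceMeasure Ω)
        ≤ C * (sobolevNorm Ω (s - w) (classicalGrad s - weakGrad Ω w)
          + sobolevNorm Ω (t - w) (classicalGrad t - weakGrad Ω w)) := by
  obtain ⟨C, hC⟩ := exists_eLpNorm_surfaceMeasure_le hb hP
  refine ⟨C, fun w s t hw hs ht => (hC (s - t) (hs.sub ht)).trans (mul_le_mul_right ?_ _)⟩
  have e1 : s - t = (s - w) - (t - w) := by abel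
  have e2 : classicalGrad (s - t)
      = (classicalGrad s - weakGrad Ω w) - (classicalGrad t - weakGrad Ω w) := by
    rw [classicalGrad_sub hs ht]; abel
  rw [e2, e1]
  exact sobolevNorm_sub_le (hs.continuous.aestronglyMeasurable.sub hw.1.1)
    (ht.continuous.aestronglyMeasurable.sub hw.1.1)
    (fun j => (aestronglyMeasurable_classicalGrad hs j).sub (hw.memLp_weakPartial j).1)
    (fun j => (aestronglyMeasurable_classicalGrad ht j).sub (hw.memLp_weakPartial j).1)

/-- The boundary values of smooth approximations in `H¹` form a Cauchy sequence in `L²` of the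
boundary, and its limit is a trace. -/
theorem exists_isTrace (hΩ : IsOpen Ω) (hb : Bornology.IsBounded Ω) (hΩ2 : HasC2Boundary Ω)
    (hw : MemH1 Ω w) : ∃ g, IsTrace Ω w g := by
  have hP : HasPatches Ω := fun x hx => hΩ2.exists_patch hΩ hx
  obtain ⟨s, hs, hlim⟩ :=
    exists_smooth_tendstoH1 hΩ hb (fun x hx => hΩ2.exists_hasInwardShift hΩ hx) hw
  obtain ⟨C, hC⟩ := exists_eLpNorm_sub_le hb hP
  have hs1 : ∀ m, ContDiff ℝ 1 (s m) := fun m => (hs m).of_le (by simp)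
  have hL : ∀ m, MemLp (s m) 2 (surfaceMeasure Ω) := fun m =>
    memLp_surfaceMeasure hb hΩ hP (hs1 m)
  have hδ := hlim.sobolevNorm
  have hcau : CauchySeq fun m => (hL m).toLp (s m) := by
    rw [EMetric.cauchySeq_iff]
    intro η hη
    have h2 : Tendsto (fun m => (C : ENNReal) * (2 * sobolevNorm Ω (s m - w)
        (classicalGrad (s m) - weakGrad Ω w))) atTop (𝓝 0) := by
      have := ENNReal.Tendsto.const_mul (ENNReal.Tendsto.const_mul hδ (a := 2) (by simp))
        (a := (C : ENNReal)) (by simp)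
      simpa using this
    obtain ⟨M, hM⟩ := eventually_atTop.1 (h2.eventually (gt_mem_nhds hη))
    refine ⟨M, fun m hm n hn => ?_⟩
    rw [Lp.edist_toLp_toLp]
    refine (hC w _ _ hw (hs1 m) (hs1 n)).trans_lt ?_
    rcases le_total (sobolevNorm Ω (s m - w) (classicalGrad (s m) - weakGrad Ω w))
      (sobolevNorm Ω (s n - w) (classicalGrad (s n) - weakGrad Ω w)) with h | h
    · refine lt_of_le_of_lt (mul_le_mul_right ?_ _) (hM n hn)
      rw [two_mul]; exact add_le_add h le_rfl
    · refine lt_of_le_of_lt (mul_le_mul_right ?_ _) (hM m hm)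
      rw [two_mul]; exact add_le_add le_rfl h
  obtain ⟨G, hG⟩ := cauchySeq_tendsto_of_complete hcau
  refine ⟨G, hw, Lp.memLp G, s, hs, hlim, ?_⟩
  rw [tendsto_iff_edist_tendsto_0] at hG
  refine hG.congr fun m => ?_
  conv_lhs => rw [← Lp.toLp_coeFn G (Lp.memLp G)]
  rw [Lp.edist_toLp_toLp]

lemma IsTrace.ae_eq (hb : Bornology.IsBounded Ω) (hP : HasPatches Ω) (h : IsTrace Ω w g)
    (h' : IsTrace Ω w g') : g' =ᵐ[surfaceMeasure Ω] g := by
  obtain ⟨hw, hg, s, hs, hsw, hsg⟩ := h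
  obtain ⟨-, hg', t, ht, htw, htg⟩ := h'
  obtain ⟨C, hC⟩ := exists_eLpNorm_sub_le hb hP
  have hs1 : ∀ m, ContDiff ℝ 1 (s m) := fun m => (hs m).of_le (by simp)
  have ht1 : ∀ m, ContDiff ℝ 1 (t m) := fun m => (ht m).of_le (by simp)
  have hlim : Tendsto (fun m => eLpNorm (t m - g') 2 (surfaceMeasure Ω)
      + (C : ENNReal) * (sobolevNorm Ω (t m - w) (classicalGrad (t m) - weakGrad Ω w)
          + sobolevNorm Ω (s m - w) (classicalGrad (s m) - weakGrad Ω w))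
      + eLpNorm (s m - g) 2 (surfaceMeasure Ω)) atTop (𝓝 0) := by
    have := (htg.add (ENNReal.Tendsto.const_mul (htw.sobolevNorm.add hsw.sobolevNorm)
      (a := (C : ENNReal)) (by simp))).add hsg
    simpa using this
  have hle : ∀ m, eLpNorm (g' - g) 2 (surfaceMeasure Ω) ≤ eLpNorm (t m - g') 2 (surfaceMeasure Ω)
      + (C : ENNReal) * (sobolevNorm Ω (t m - w) (classicalGrad (t m) - weakGrad Ω w)
          + sobolevNorm Ω (s m - w) (classicalGrad (s m) - weakGrad Ω w))
      + eLpNorm (s m - g) 2 (surfaceMeasure Ω) := by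
    intro m
    have e : g' - g = (-(t m - g') + (t m - s m)) + (s m - g) := by abel
    have m1 : AEStronglyMeasurable (t m - g') (surfaceMeasure Ω) :=
      (ht m).continuous.aestronglyMeasurable.sub hg'.1
    have m2 : AEStronglyMeasurable (t m - s m) (surfaceMeasure Ω) :=
      (ht m).continuous.aestronglyMeasurable.sub (hs m).continuous.aestronglyMeasurable
    have m3 : AEStronglyMeasurable (s m - g) (surfaceMeasure Ω) :=
      (hs m).continuous.aestronglyMeasurable.sub hg.1
    rw [e]
    refine (eLpNorm_add_le (m1.neg.add m2) m3 (by norm_num)).trans (add_le_add ?_ le_rfl)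
    refine (eLpNorm_add_le m1.neg m2 (by norm_num)).trans (add_le_add (eLpNorm_neg _ _ _).le ?_)
    exact hC w _ _ hw (ht1 m) (hs1 m)
  have h0 : eLpNorm (g' - g) 2 (surfaceMeasure Ω) = 0 :=
    le_antisymm (ge_of_tendsto' hlim hle) zero_le
  rw [eLpNorm_eq_zero_iff (hg'.1.sub hg.1) (by norm_num)] at h0
  filter_upwards [h0] with x hx
  simpa [sub_eq_zero] using hx

/-- Continuity of the trace operator. -/
lemma exists_eLpNorm_trace_le (hb : Bornology.IsBounded Ω) (hP : HasPatches Ω) :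
    ∃ C : NNReal, ∀ w g, IsTrace Ω w g →
      eLpNorm g 2 (surfaceMeasure Ω) ≤ C * sobolevNorm Ω w (weakGrad Ω w) := by
  obtain ⟨C, hC⟩ := exists_eLpNorm_surfaceMeasure_le hb hP
  refine ⟨C, ?_⟩
  rintro w g ⟨hw, hg, s, hs, hsw, hsg⟩
  have hs1 : ∀ m, ContDiff ℝ 1 (s m) := fun m => (hs m).of_le (by simp)
  have hlim : Tendsto (fun m => eLpNorm (s m - g) 2 (surfaceMeasure Ω)
      + (C : ENNReal) * (sobolevNorm Ω (s m - w) (classicalGrad (s m) - weakGrad Ω w)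
          + sobolevNorm Ω w (weakGrad Ω w))) atTop
      (𝓝 (C * sobolevNorm Ω w (weakGrad Ω w))) := by
    have := hsg.add (ENNReal.Tendsto.const_mul (hsw.sobolevNorm.add
      (tendsto_const_nhds (x := sobolevNorm Ω w (weakGrad Ω w))))
      (a := (C : ENNReal)) (by simp))
    simpa using this
  refine ge_of_tendsto' hlim fun m => ?_
  have e : g = -(s m - g) + s m := by abel
  have m1 : AEStronglyMeasurable (s m - g) (surfaceMeasure Ω) :=
    (hs m).continuous.aestronglyMeasurable.sub hg.1
  conv_lhs => rw [e]
  refine (eLpNorm_add_le m1.neg (hs m).continuous.aestronglyMeasurable (by norm_num)).trans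
    (add_le_add (eLpNorm_neg _ _ _).le ((hC _ (hs1 m)).trans (mul_le_mul_right ?_ _)))
  have e1 : s m = (s m - w) + w := by abel
  have e2 : classicalGrad (s m) = (classicalGrad (s m) - weakGrad Ω w) + weakGrad Ω w := by abel
  calc sobolevNorm Ω (s m) (classicalGrad (s m))
      = sobolevNorm Ω ((s m - w) + w) ((classicalGrad (s m) - weakGrad Ω w) + weakGrad Ω w) := by
        rw [← e1, ← e2]
    _ ≤ _ := sobolevNorm_add_le ((hs m).continuous.aestronglyMeasurable.sub hw.1.1) hw.1.1
        (fun j => (aestronglyMeasurable_classicalGrad (hs1 m) j).sub (hw.memLp_weakPartial j).1)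
        (fun j => (hw.memLp_weakPartial j).1)

lemma tendsto_eLpNorm_const_smul_add {μ : Measure E3} {s t : ℕ → E3 → ℝ} (c : ℝ)
    (hs : ∀ m, AEStronglyMeasurable (s m) μ) (ht : ∀ m, AEStronglyMeasurable (t m) μ)
    (hu : AEStronglyMeasurable u μ) (hv : AEStronglyMeasurable v μ)
    (hsu : Tendsto (fun m => eLpNorm (s m - u) 2 μ) atTop (𝓝 0))
    (htv : Tendsto (fun m => eLpNorm (t m - v) 2 μ) atTop (𝓝 0)) :
    Tendsto (fun m => eLpNorm (c • s m + t m - (c • u + v)) 2 μ) atTop (𝓝 0) := by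
  have h0 : Tendsto (fun m => ‖c‖ₑ * eLpNorm (s m - u) 2 μ + eLpNorm (t m - v) 2 μ) atTop
      (𝓝 0) := by
    simpa using (ENNReal.Tendsto.const_mul hsu (a := ‖c‖ₑ) (by simp)).add htv
  refine tendsto_of_tendsto_of_tendsto_of_le_of_le tendsto_const_nhds h0
    (fun _ => zero_le) fun m => ?_
  have e : c • s m + t m - (c • u + v) = c • (s m - u) + (t m - v) := by
    rw [smul_sub]; abel
  simp only
  rw [e, ← eLpNorm_const_smul]
  exact eLpNorm_add_le (((hs m).sub hu).const_smul c) ((ht m).sub hv) (by norm_num)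

lemma TendstoH1.const_smul_add (hΩ : IsOpen Ω) {s t : ℕ → E3 → ℝ} (c : ℝ) (hu : MemH1 Ω u)
    (hv : MemH1 Ω v) (hs : ∀ m, ContDiff ℝ ∞ (s m)) (ht : ∀ m, ContDiff ℝ ∞ (t m))
    (hsu : TendstoH1 Ω s u) (htv : TendstoH1 Ω t v) :
    TendstoH1 Ω (fun m => c • s m + t m) (c • u + v) := by
  refine ⟨tendsto_eLpNorm_const_smul_add c (fun m => (hs m).continuous.aestronglyMeasurable)
    (fun m => (ht m).continuous.aestronglyMeasurable) hu.1.1 hv.1.1 hsu.1 htv.1, fun j => ?_⟩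
  refine (tendsto_eLpNorm_const_smul_add c
    (fun m => (hs m).classicalPartial.continuous.aestronglyMeasurable)
    (fun m => (ht m).classicalPartial.continuous.aestronglyMeasurable)
    (hu.memLp_weakPartial j).1 (hv.memLp_weakPartial j).1 (hsu.2 j) (htv.2 j)).congr
      fun m => eLpNorm_congr_ae ?_
  have e : classicalPartial j (c • s m + t m)
      = c • classicalPartial j (s m) + classicalPartial j (t m) := by
    ext x
    have h1 := (hs m).differentiable (by simp) x
    have h2 := (ht m).differentiable (by simp) x
    unfold classicalPartial
    rw [fderiv_add (h1.const_smul c) h2, fderiv_const_smul h1]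
    simp
  rw [e]
  exact (ae_eq_refl _).sub (weakPartial_const_smul_add hΩ c hu hv j).symm

lemma IsTrace.const_smul_add (hΩ : IsOpen Ω) (c : ℝ) (h : IsTrace Ω u g) (h' : IsTrace Ω v g') :
    IsTrace Ω (c • u + v) (c • g + g') := by
  obtain ⟨hu, hg, s, hs, hsu, hsg⟩ := h
  obtain ⟨hv, hg', t, ht, htv, htg⟩ := h'
  exact ⟨hu.const_smul_add c hv, (hg.const_smul c).add hg', fun m => c • s m + t m,
    fun m => (contDiff_const.smul (hs m)).add (ht m), hsu.const_smul_add hΩ c hu hv hs ht htv,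
    tendsto_eLpNorm_const_smul_add c (fun m => (hs m).continuous.aestronglyMeasurable)
      (fun m => (ht m).continuous.aestronglyMeasurable) hg.1 hg'.1 hsg htg⟩

lemma IsTrace.congr (hΩ : IsOpen Ω) (h : IsTrace Ω u g) (huv : u =ᵐ[volOn Ω] v) :
    IsTrace Ω v g := by
  obtain ⟨hu, hg, s, hs, hsu, hsg⟩ := h
  refine ⟨hu.congr huv, hg, s, hs, ⟨hsu.1.congr fun m => ?_, fun j => (hsu.2 j).congr fun m => ?_⟩,
    hsg⟩
  · exact eLpNorm_congr_ae ((ae_eq_refl _).sub huv)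
  · exact eLpNorm_congr_ae ((ae_eq_refl _).sub (weakPartial_congr hΩ hu huv j))

lemma isTrace_trace (h : ∃ g, IsTrace Ω w g) : IsTrace Ω w (trace Ω w) := by
  rw [trace, dif_pos h]
  exact h.choose_spec

/-- Green's formula on a boundary patch, for functions with a trace. -/
lemma BoundaryPatch.green (hΩ : IsOpen Ω) (hb : Bornology.IsBounded Ω)
    {x : E3} (P : BoundaryPatch Ω x) (h : IsTrace Ω w g) {ψ : E3 → ℝ} (hψ : ContDiff ℝ ∞ ψ)
    (hψc : HasCompactSupport ψ) (hψs : tsupport ψ ⊆ Metric.ball x P.r) (i : Fin 3) :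
    ∫ y, (P.N y i * ψ y) * g y ∂P.m
      = ∫ y, classicalPartial i ψ y * w y ∂(volOn Ω)
        + ∫ y, ψ y * weakPartial Ω i w y ∂(volOn Ω) := by
  obtain ⟨hw, hg, s, hs, hsw, hsg⟩ := h
  have := P.finite_m
  have hψ1 : ContDiff ℝ 1 ψ := hψ.of_le (by simp)
  have hs1 : ∀ m, ContDiff ℝ 1 (s m) := fun m => (hs m).of_le (by simp)
  have hNc : Continuous fun y => P.N y i :=
    (EuclideanSpace.proj (𝕜 := ℝ) i).continuous.comp P.continuous_N
  have hNψ : MemLp (fun y => P.N y i * ψ y) 2 P.m :=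
    HasCompactSupport.memLp_two hψc.mul_left (hNc.mul hψ.continuous)
  have hψL : MemLp ψ 2 (volOn Ω) := memLp_volOn_of_continuous hb hΩ hψ.continuous
  have hψL' : MemLp (classicalPartial i ψ) 2 (volOn Ω) :=
    memLp_volOn_of_continuous hb hΩ hψ.classicalPartial.continuous
  have hgm : MemLp g 2 P.m := hg.mono_measure P.m_le
  have hsgm : ∀ᶠ m in atTop, MemLp (s m) 2 P.m := by
    filter_upwards [hsg.eventually (gt_mem_nhds one_pos)] with m hm
    have h1 : MemLp (s m - g) 2 (surfaceMeasure Ω) :=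
      ⟨(hs m).continuous.aestronglyMeasurable.sub hg.1, hm.trans (by simp)⟩
    have h2 := (h1.add hg).mono_measure P.m_le
    simpa using h2
  obtain ⟨M, hM⟩ := eventually_atTop.1 hsgm
  have l1 := tendsto_integral_mul (s := fun m => s (m + M)) hNψ hgm
    (fun m => hM _ (Nat.le_add_left M m))
    (tendsto_of_tendsto_of_tendsto_of_le_of_le tendsto_const_nhds
      (hsg.comp (tendsto_add_atTop_nat M)) (fun _ => zero_le)
      fun m => eLpNorm_mono_measure _ P.m_le)
  have l2 := tendsto_integral_mul (s := fun m => s (m + M)) hψL' hw.1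
    (fun m => memLp_volOn_of_continuous hb hΩ (hs _).continuous)
    (hsw.1.comp (tendsto_add_atTop_nat M))
  have l3 := tendsto_integral_mul (s := fun m => classicalPartial i (s (m + M))) hψL
    (hw.memLp_weakPartial i)
    (fun m => memLp_volOn_of_continuous hb hΩ (hs _).classicalPartial.continuous)
    ((hsw.2 i).comp (tendsto_add_atTop_nat M))
  refine tendsto_nhds_unique l1 ((l2.add l3).congr fun m => ?_)
  have h1 := P.divergence (fun y => ψ y * s (m + M) y) (hψ1.mul (hs1 _)) hψc.mul_right
    (tsupport_mul_subset_left.trans hψs) (unitVec i)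
  have h2 : ∀ y, inner ℝ (P.N y) (unitVec i) * (ψ y * s (m + M) y)
      = P.N y i * ψ y * s (m + M) y := by
    intro y
    simp [unitVec, EuclideanSpace.inner_single_right]
    ring
  have h3 : ∀ y, fderiv ℝ (fun y => ψ y * s (m + M) y) y (unitVec i)
      = classicalPartial i ψ y * s (m + M) y + ψ y * classicalPartial i (s (m + M)) y := by
    intro y
    have := classicalPartial_mul (j := i) hψ1 (hs1 (m + M)) y
    rw [classicalPartial] at this
    rw [this]; ring
  simp_rw [h2, h3] at h1
  rw [← h1, integral_add]
  · exact integrable_mul_of_memLp_two hψL' (memLp_volOn_of_continuous hb hΩ (hs _).continuous)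
  · exact integrable_mul_of_memLp_two hψL
      (memLp_volOn_of_continuous hb hΩ (hs _).classicalPartial.continuous)

/-! ### The gradient on the boundary of a function vanishing there -/

lemma integral_partial_mul_partial {ψ s : E3 → ℝ}
    (hψ : ContDiff ℝ ∞ ψ) (hs : IsTestFunction Ω s) (i j : Fin 3) :
    ∫ y, classicalPartial i ψ y * classicalPartial j s y ∂(volOn Ω)
      = -∫ y, ψ y * classicalPartial i (classicalPartial j s) y ∂(volOn Ω) := by
  have ht : IsTestFunction Ω (classicalPartial j s) := hs.classicalPartial
  have htt : IsTestFunction Ω (classicalPartial i (classicalPartial j s)) := ht.classicalPartial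
  have key : ∀ f φ : E3 → ℝ, IsTestFunction Ω φ →
      ∫ y, f y * φ y ∂(volOn Ω) = ∫ y, f y * φ y := by
    intro f φ hφ
    refine setIntegral_eq_integral_of_forall_compl_eq_zero fun y hy => ?_
    rw [image_eq_zero_of_notMem_tsupport fun h => hy (hφ.2.2 h), mul_zero]
  rw [key _ _ ht, key _ _ htt]
  have hi : ∀ f φ : E3 → ℝ, Continuous f → IsTestFunction Ω φ → Integrable fun y => f y * φ y :=
    fun f φ hf hφ => (hf.mul hφ.1.continuous).integrable_of_hasCompactSupport hφ.2.1.mul_left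
  have := integral_mul_fderiv_eq_neg_fderiv_mul_of_integrable (μ := (volume : Measure E3))
    (f := ψ) (g := classicalPartial j s) (v := unitVec i)
    (hi _ _ hψ.classicalPartial.continuous ht) (hi _ _ hψ.continuous htt)
    (hi _ _ hψ.continuous ht) (fun y _ => hψ.differentiable (by simp) y)
    (fun y _ => ht.1.differentiable (by simp) y)
  simp only [classicalPartial] at this ⊢
  rw [this, neg_neg]

/-- For a function in `H²` that vanishes on the boundary, the boundary values of the gradient are
parallel to the normal: tested against a smooth function, the tangential components become, by
Green's formula, an expression in the first derivatives on `Ω` that vanishes for test functions. -/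
lemma BoundaryPatch.ae_normal_mul_eq (hΩ : IsOpen Ω) (hb : Bornology.IsBounded Ω) {x : E3}
    (P : BoundaryPatch Ω x) (hu : MemH2 Ω u) (hu0 : MemH10 Ω u) {i j : Fin 3}
    (hg : IsTrace Ω (weakPartial Ω i u) g) (hg' : IsTrace Ω (weakPartial Ω j u) g') :
    ∀ᵐ y ∂P.m, y ∈ Metric.ball x P.r → P.N y i * g' y = P.N y j * g y := by
  have := P.finite_m
  have hNc : ∀ i, Continuous fun y => P.N y i := fun i =>
    (EuclideanSpace.proj (𝕜 := ℝ) i).continuous.comp P.continuous_N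
  have hgm : ∀ {w g : E3 → ℝ}, IsTrace Ω w g → MemLp g 2 P.m := fun h => h.2.1.mono_measure P.m_le
  have hloc : ∀ {w g : E3 → ℝ} (i), IsTrace Ω w g → LocallyIntegrable (fun y => P.N y i * g y) P.m :=
    fun i h => (hgm h |>.locallyIntegrable (by norm_num)).continuous_mul (hNc i)
  have hzero := Metric.isOpen_ball.ae_eq_zero_of_integral_contDiff_smul_eq_zero
    (U := Metric.ball x P.r) (μ := P.m) (f := fun y => P.N y i * g' y - P.N y j * g y)
    (((hloc i hg').sub (hloc j hg)).locallyIntegrableOn _) fun ψ hψ hψc hψs => by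
      have hNψ : ∀ i, MemLp (fun y => P.N y i * ψ y) 2 P.m := fun i =>
        HasCompactSupport.memLp_two hψc.mul_left ((hNc i).mul hψ.continuous)
      have e : ∀ y, ψ y • (P.N y i * g' y - P.N y j * g y)
          = (P.N y i * ψ y) * g' y - (P.N y j * ψ y) * g y := fun y => by
        simp only [smul_eq_mul]; ring
      simp_rw [e]
      rw [integral_sub (integrable_mul_of_memLp_two (hNψ i) (hgm hg'))
        (integrable_mul_of_memLp_two (hNψ j) (hgm hg)), P.green hΩ hb hg' hψ hψc hψs,
        P.green hΩ hb hg hψ hψc hψs]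
      have hcomm : ∫ y, ψ y * weakPartial Ω i (weakPartial Ω j u) y ∂(volOn Ω)
          = ∫ y, ψ y * weakPartial Ω j (weakPartial Ω i u) y ∂(volOn Ω) :=
        integral_congr_ae ((hu.weakPartial_comm hΩ i j).mono fun y hy => by simp [hy])
      obtain ⟨-, s, hs, hsu⟩ := hu0
      have lim : ∀ a b : Fin 3, Tendsto (fun m => ∫ y, classicalPartial a ψ y
          * classicalPartial b (s m) y ∂(volOn Ω)) atTop
          (𝓝 (∫ y, classicalPartial a ψ y * weakPartial Ω b u y ∂(volOn Ω))) := fun a b =>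
        tendsto_integral_mul (memLp_volOn_of_continuous hb hΩ hψ.classicalPartial.continuous)
          (hu.1.memLp_weakPartial b) (fun m => (hs m).classicalPartial.memLp) (hsu.2 b)
      have heq : ∫ y, classicalPartial i ψ y * weakPartial Ω j u y ∂(volOn Ω)
          = ∫ y, classicalPartial j ψ y * weakPartial Ω i u y ∂(volOn Ω) := by
        refine tendsto_nhds_unique (lim i j) ((lim j i).congr fun m => ?_)
        rw [integral_partial_mul_partial hψ (hs m),
          integral_partial_mul_partial hψ (hs m), classicalPartial_comm (hs m).1]
      rw [hcomm, heq, sub_self]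
  filter_upwards [hzero] with y hy hyr
  linarith [hy hyr]

/-- The vanishing of the tangential derivatives, on the whole boundary. -/
lemma ae_nu_mul_trace_eq (hΩ : IsOpen Ω) (hb : Bornology.IsBounded Ω) (hP : HasPatches Ω)
    (hu : MemH2 Ω u) (hu0 : MemH10 Ω u) {i j : Fin 3}
    (hg : IsTrace Ω (weakPartial Ω i u) g) (hg' : IsTrace Ω (weakPartial Ω j u) g') :
    ∀ᵐ y ∂surfaceMeasure Ω, nu Ω y i * g' y = nu Ω y j * g y := by
  refine ae_surfaceMeasure_of_locally fun x hx => ?_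
  obtain ⟨P⟩ := hP x hx
  refine ⟨P.r, P.r_pos, ?_⟩
  have h1 := P.ae_normal_mul_eq hΩ hb hu hu0 hg hg'
  have h2 : ∀ᵐ y ∂(surfaceMeasure Ω).restrict (Metric.ball x P.r),
      y ∈ Metric.ball x P.r → P.N y i * g' y = P.N y j * g y :=
    (Measure.absolutelyContinuous_of_le P.le_m).ae_le
      ((Measure.smul_absolutelyContinuous (μ := P.m)).ae_le h1)
  have h3 : ∀ᵐ y ∂(surfaceMeasure Ω).restrict (Metric.ball x P.r), y ∈ frontier Ω :=
    ae_restrict_of_ae (ae_restrict_mem isClosed_frontier.measurableSet)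
  filter_upwards [h2, h3, ae_restrict_mem Metric.isOpen_ball.measurableSet] with y a1 a2 a3
  simp only [nu, P.outwardNormal_eq a2 a3, PiLp.smul_apply, smul_eq_mul]
  rw [mul_assoc, mul_assoc, a1 a3]

end

/-! ### The fields entering the form -/

section

variable {Ω : Set E3} {w w' : E3 → ℝ} {u v φ : Field3}

/-- A bounded open set with boundary of class `C²`. -/
structure IsC2Domain (Ω : Set E3) : Prop where
  isOpen : IsOpen Ω
  isBounded : Bornology.IsBounded Ω
  boundary : HasC2Boundary Ω

namespace IsC2Domain

lemma hasPatches (hD : IsC2Domain Ω) : HasPatches Ω := fun _ hx =>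
  hD.boundary.exists_patch hD.isOpen hx

lemma isTrace_trace (hD : IsC2Domain Ω) (hw : MemH1 Ω w) : IsTrace Ω w (trace Ω w) :=
  WallEddy.isTrace_trace (exists_isTrace hD.isOpen hD.isBounded hD.boundary hw)

lemma memLp_trace (hD : IsC2Domain Ω) (hw : MemH1 Ω w) : MemLp (trace Ω w) 2 (surfaceMeasure Ω) :=
  (hD.isTrace_trace hw).2.1

lemma trace_ae_eq (hD : IsC2Domain Ω) {g : E3 → ℝ} (h : IsTrace Ω w g) :
    trace Ω w =ᵐ[surfaceMeasure Ω] g :=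
  h.ae_eq hD.isBounded hD.hasPatches (WallEddy.isTrace_trace ⟨g, h⟩)

lemma trace_congr (hD : IsC2Domain Ω) (hw : MemH1 Ω w) (h : w =ᵐ[volOn Ω] w') :
    trace Ω w' =ᵐ[surfaceMeasure Ω] trace Ω w :=
  hD.trace_ae_eq ((hD.isTrace_trace hw).congr hD.isOpen h)

lemma trace_const_smul_add (hD : IsC2Domain Ω) (c : ℝ) (hw : MemH1 Ω w) (hw' : MemH1 Ω w') :
    trace Ω (c • w + w') =ᵐ[surfaceMeasure Ω] c • trace Ω w + trace Ω w' :=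
  hD.trace_ae_eq ((hD.isTrace_trace hw).const_smul_add hD.isOpen c (hD.isTrace_trace hw'))

lemma trace_sub (hD : IsC2Domain Ω) (hw : MemH1 Ω w) (hw' : MemH1 Ω w') :
    trace Ω (w - w') =ᵐ[surfaceMeasure Ω] trace Ω w - trace Ω w' := by
  have e : w - w' = (-1 : ℝ) • w' + w := by ext x; simp; ring
  rw [e]
  refine (hD.trace_const_smul_add (-1) hw' hw).trans (Eventually.of_forall fun x => ?_)
  simp; ring

end IsC2Domain

lemma MemH2.const_smul_add (hΩ : IsOpen Ω) (c : ℝ) (hw : MemH2 Ω w) (hw' : MemH2 Ω w') :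
    MemH2 Ω (c • w + w') :=
  ⟨hw.1.const_smul_add c hw'.1, fun j => ((hw.2 j).const_smul_add c (hw'.2 j)).congr
    (weakPartial_const_smul_add hΩ c hw.1 hw'.1 j).symm⟩

lemma FieldMemH2.const_smul_add (hΩ : IsOpen Ω) (c : ℝ) (hu : FieldMemH2 Ω u)
    (hv : FieldMemH2 Ω v) : FieldMemH2 Ω (c • u + v) := fun i =>
  (hu i).const_smul_add hΩ c (hv i)

/-- Each component of the curl is a difference of first derivatives. -/
lemma exists_curl_eq (i : Fin 3) : ∃ a b : Fin 3, ∀ (Ω : Set E3) (u : Field3),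
    curl Ω u i = weakPartial Ω a (u b) - weakPartial Ω b (u a) := by
  fin_cases i
  exacts [⟨1, 2, fun _ _ => rfl⟩, ⟨2, 0, fun _ _ => rfl⟩, ⟨0, 1, fun _ _ => rfl⟩]

lemma FieldMemH2.memH1_curl (hu : FieldMemH2 Ω u) (i : Fin 3) : MemH1 Ω (curl Ω u i) := by
  obtain ⟨a, b, h⟩ := exists_curl_eq i
  rw [h]
  exact ((hu b).2 a).sub ((hu a).2 b)

lemma curl_const_smul_add (hΩ : IsOpen Ω) (c : ℝ) (hu : FieldMemH2 Ω u) (hv : FieldMemH2 Ω v)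
    (i : Fin 3) : curl Ω (c • u + v) i =ᵐ[volOn Ω] c • curl Ω u i + curl Ω v i := by
  obtain ⟨a, b, h⟩ := exists_curl_eq i
  simp only [h]
  filter_upwards [weakPartial_const_smul_add hΩ c (hu b).1 (hv b).1 a,
    weakPartial_const_smul_add hΩ c (hu a).1 (hv a).1 b] with x h1 h2
  simp only [Pi.sub_apply, Pi.add_apply, Pi.smul_apply, smul_eq_mul] at h1 h2 ⊢
  rw [h1, h2]; ring

lemma grad_curl_const_smul_add (hΩ : IsOpen Ω) (c : ℝ) (hu : FieldMemH2 Ω u)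
    (hv : FieldMemH2 Ω v) : ∀ᵐ x ∂(volOn Ω), grad Ω (curl Ω (c • u + v)) x
      = c • grad Ω (curl Ω u) x + grad Ω (curl Ω v) x := by
  have h : ∀ i j, weakPartial Ω j (curl Ω (c • u + v) i) =ᵐ[volOn Ω]
      c • weakPartial Ω j (curl Ω u i) + weakPartial Ω j (curl Ω v i) := fun i j =>
    (weakPartial_congr hΩ ((hu.const_smul_add hΩ c hv).memH1_curl i)
      (curl_const_smul_add hΩ c hu hv i) j).trans
      (weakPartial_const_smul_add hΩ c (hu.memH1_curl i) (hv.memH1_curl i) j)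
  filter_upwards [eventually_all.2 fun i => eventually_all.2 (h i)] with x hx
  ext i j
  simpa [grad] using hx i j

lemma fieldTrace_curl_const_smul_add (hD : IsC2Domain Ω) (c : ℝ) (hu : FieldMemH2 Ω u)
    (hv : FieldMemH2 Ω v) : ∀ᵐ x ∂(surfaceMeasure Ω), fieldTrace Ω (curl Ω (c • u + v)) x
      = c • fieldTrace Ω (curl Ω u) x + fieldTrace Ω (curl Ω v) x := by
  have h : ∀ i, trace Ω (curl Ω (c • u + v) i) =ᵐ[surfaceMeasure Ω]
      c • trace Ω (curl Ω u i) + trace Ω (curl Ω v i) := fun i =>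
    (hD.trace_congr ((hu.const_smul_add hD.isOpen c hv).memH1_curl i)
      (curl_const_smul_add hD.isOpen c hu hv i)).symm.trans
      (hD.trace_const_smul_add c (hu.memH1_curl i) (hv.memH1_curl i))
  filter_upwards [eventually_all.2 h] with x hx
  ext i
  simpa [fieldTrace] using hx i

lemma normalDeriv_const_smul_add (hD : IsC2Domain Ω) (c : ℝ) (hu : FieldMemH2 Ω u)
    (hv : FieldMemH2 Ω v) : ∀ᵐ x ∂(surfaceMeasure Ω), normalDeriv Ω (c • u + v) x
      = c • normalDeriv Ω u x + normalDeriv Ω v x := by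
  have h : ∀ i j, trace Ω (weakPartial Ω j ((c • u + v) i)) =ᵐ[surfaceMeasure Ω]
      c • trace Ω (weakPartial Ω j (u i)) + trace Ω (weakPartial Ω j (v i)) := fun i j =>
    (hD.trace_congr (((hu i).const_smul_add hD.isOpen c (hv i)).2 j)
      (weakPartial_const_smul_add hD.isOpen c (hu i).1 (hv i).1 j)).symm.trans
      (hD.trace_const_smul_add c ((hu i).2 j) ((hv i).2 j))
  filter_upwards [eventually_all.2 fun i => eventually_all.2 (h i)] with x hx
  ext i
  simp only [normalDeriv, Pi.add_apply, Pi.smul_apply, smul_eq_mul] at hx ⊢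
  rw [Finset.mul_sum, ← Finset.sum_add_distrib]
  refine Finset.sum_congr rfl fun j _ => ?_
  rw [hx i j]; ring

/-! ### Integrability, and bounds in terms of the `H²` norm -/

lemma memLp_grad_curl (hu : FieldMemH2 Ω u) (i j : Fin 3) :
    MemLp (fun x => grad Ω (curl Ω u) x i j) 2 (volOn Ω) :=
  (hu.memH1_curl i).memLp_weakPartial j

lemma memLp_stressG (γ : ℝ) (hu : FieldMemH2 Ω u) (i j : Fin 3) :
    MemLp (fun x => stressG Ω γ u x i j) 2 (volOn Ω) :=
  (memLp_grad_curl hu i j).add ((memLp_grad_curl hu j i).const_smul γ)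

lemma integrable_frob (γ : ℝ) (hu : FieldMemH2 Ω u) (hφ : FieldMemH2 Ω φ) :
    Integrable (fun x => frob (stressG Ω γ u x) (grad Ω (curl Ω φ) x)) (volOn Ω) := by
  unfold frob
  exact integrable_finsetSum _ fun i _ => integrable_finsetSum _ fun j _ =>
    integrable_mul_of_memLp_two (memLp_stressG γ hu i j) (memLp_grad_curl hφ i j)

lemma memLp_nu_mul (hP : HasPatches Ω) {g : E3 → ℝ} (hg : MemLp g 2 (surfaceMeasure Ω))
    (i : Fin 3) : MemLp (fun x => nu Ω x i * g x) 2 (surfaceMeasure Ω) :=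
  hg.bdd_mul_two (aestronglyMeasurable_nu hP i) fun x => abs_nu_le x i

lemma memLp_normalDeriv (hD : IsC2Domain Ω) (hu : FieldMemH2 Ω u) (i : Fin 3) :
    MemLp (fun x => normalDeriv Ω u x i) 2 (surfaceMeasure Ω) := by
  unfold normalDeriv
  refine memLp_finsetSum _ fun j _ => ?_
  simp_rw [mul_comm]
  exact memLp_nu_mul hD.hasPatches (hD.memLp_trace ((hu i).2 j)) j

lemma memLp_nu_cross (hD : IsC2Domain Ω) (hu : FieldMemH2 Ω u) (i : Fin 3) :
    MemLp (fun x => (nu Ω x ⨯₃ fieldTrace Ω (curl Ω u) x) i) 2 (surfaceMeasure Ω) := by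
  have h : ∀ a b, MemLp (fun x => nu Ω x a * fieldTrace Ω (curl Ω u) x b) 2 (surfaceMeasure Ω) :=
    fun a b => memLp_nu_mul hD.hasPatches (hD.memLp_trace (hu.memH1_curl b)) a
  fin_cases i
  exacts [(h 1 2).sub (h 2 1), (h 2 0).sub (h 0 2), (h 0 1).sub (h 1 0)]

lemma integrable_boundary (hD : IsC2Domain Ω) (hu : FieldMemH2 Ω u) (hφ : FieldMemH2 Ω φ) :
    Integrable (fun x => (nu Ω x ⨯₃ fieldTrace Ω (curl Ω u) x) ⬝ᵥ normalDeriv Ω φ x)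
      (surfaceMeasure Ω) := by
  unfold dotProduct
  exact integrable_finsetSum _ fun i _ =>
    integrable_mul_of_memLp_two (memLp_nu_cross hD hu i) (memLp_normalDeriv hD hφ i)

lemma form_const_smul_add_left (hD : IsC2Domain Ω) (γ k c : ℝ) (hu : FieldMemH2 Ω u)
    (hv : FieldMemH2 Ω v) (hφ : FieldMemH2 Ω φ) :
    form Ω γ k (c • u + v) φ = c * form Ω γ k u φ + form Ω γ k v φ := by
  have h1 : ∫ x, frob (stressG Ω γ (c • u + v) x) (grad Ω (curl Ω φ) x) ∂(volOn Ω)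
      = c * ∫ x, frob (stressG Ω γ u x) (grad Ω (curl Ω φ) x) ∂(volOn Ω)
        + ∫ x, frob (stressG Ω γ v x) (grad Ω (curl Ω φ) x) ∂(volOn Ω) := by
    rw [← integral_const_mul, ← integral_add ((integrable_frob γ hu hφ).const_mul c)
      (integrable_frob γ hv hφ)]
    refine integral_congr_ae ?_
    filter_upwards [grad_curl_const_smul_add hD.isOpen c hu hv] with x hx
    simp only [stressG, hx, frob, Fin.sum_univ_three, Matrix.add_apply, Matrix.smul_apply,
      Matrix.transpose_apply, smul_eq_mul]
    ring
  have h2 : ∫ x, (nu Ω x ⨯₃ fieldTrace Ω (curl Ω (c • u + v)) x) ⬝ᵥ normalDeriv Ω φ x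
        ∂(surfaceMeasure Ω)
      = c * ∫ x, (nu Ω x ⨯₃ fieldTrace Ω (curl Ω u) x) ⬝ᵥ normalDeriv Ω φ x ∂(surfaceMeasure Ω)
        + ∫ x, (nu Ω x ⨯₃ fieldTrace Ω (curl Ω v) x) ⬝ᵥ normalDeriv Ω φ x
          ∂(surfaceMeasure Ω) := by
    rw [← integral_const_mul, ← integral_add ((integrable_boundary hD hu hφ).const_mul c)
      (integrable_boundary hD hv hφ)]
    refine integral_congr_ae ?_
    filter_upwards [fieldTrace_curl_const_smul_add hD c hu hv] with x hx
    rw [hx, map_add, map_smul, add_dotProduct, smul_dotProduct, smul_eq_mul]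
  rw [form, form, form, h1, h2]
  ring

lemma form_const_smul_add_right (hD : IsC2Domain Ω) (γ k c : ℝ) (hu : FieldMemH2 Ω u)
    (hv : FieldMemH2 Ω v) (hφ : FieldMemH2 Ω φ) :
    form Ω γ k φ (c • u + v) = c * form Ω γ k φ u + form Ω γ k φ v := by
  have h1 : ∫ x, frob (stressG Ω γ φ x) (grad Ω (curl Ω (c • u + v)) x) ∂(volOn Ω)
      = c * ∫ x, frob (stressG Ω γ φ x) (grad Ω (curl Ω u) x) ∂(volOn Ω)
        + ∫ x, frob (stressG Ω γ φ x) (grad Ω (curl Ω v) x) ∂(volOn Ω) := by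
    rw [← integral_const_mul, ← integral_add ((integrable_frob γ hφ hu).const_mul c)
      (integrable_frob γ hφ hv)]
    refine integral_congr_ae ?_
    filter_upwards [grad_curl_const_smul_add hD.isOpen c hu hv] with x hx
    simp only [hx, frob, Fin.sum_univ_three, Matrix.add_apply, Matrix.smul_apply, smul_eq_mul]
    ring
  have h2 : ∫ x, (nu Ω x ⨯₃ fieldTrace Ω (curl Ω φ) x) ⬝ᵥ normalDeriv Ω (c • u + v) x
        ∂(surfaceMeasure Ω)
      = c * ∫ x, (nu Ω x ⨯₃ fieldTrace Ω (curl Ω φ) x) ⬝ᵥ normalDeriv Ω u x ∂(surfaceMeasure Ω)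
        + ∫ x, (nu Ω x ⨯₃ fieldTrace Ω (curl Ω φ) x) ⬝ᵥ normalDeriv Ω v x
          ∂(surfaceMeasure Ω) := by
    rw [← integral_const_mul, ← integral_add ((integrable_boundary hD hφ hu).const_mul c)
      (integrable_boundary hD hφ hv)]
    refine integral_congr_ae ?_
    filter_upwards [normalDeriv_const_smul_add hD c hu hv] with x hx
    rw [hx, dotProduct_add, dotProduct_smul, smul_eq_mul]
  rw [form, form, form, h1, h2]
  ring

/-- The norm of `H²(Ω)³`, extended-valued. -/
def enormH2 (Ω : Set E3) (u : Field3) : ENNReal := ENNReal.ofReal (normH2 Ω u)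

lemma eLpNorm_le_enormH2_of_sq_le {f : E3 → ℝ} (hf : MemLp f 2 (volOn Ω))
    (h : normL2 Ω f ^ 2 ≤ ∑ i, (normL2 Ω (u i) ^ 2 + ∑ j, normL2 Ω (weakPartial Ω j (u i)) ^ 2
      + ∑ j, ∑ l, normL2 Ω (weakPartial Ω l (weakPartial Ω j (u i))) ^ 2)) :
    eLpNorm f 2 (volOn Ω) ≤ enormH2 Ω u := by
  rw [← ENNReal.ofReal_toReal hf.2.ne]
  exact ENNReal.ofReal_le_ofReal (Real.le_sqrt_of_sq_le h)

lemma eLpNorm_weakPartial_le (hu : FieldMemH2 Ω u) (i j : Fin 3) :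
    eLpNorm (weakPartial Ω j (u i)) 2 (volOn Ω) ≤ enormH2 Ω u := by
  refine eLpNorm_le_enormH2_of_sq_le ((hu i).1.memLp_weakPartial j) ?_
  calc normL2 Ω (weakPartial Ω j (u i)) ^ 2 ≤ ∑ j, normL2 Ω (weakPartial Ω j (u i)) ^ 2 :=
        Finset.single_le_sum (f := fun j => normL2 Ω (weakPartial Ω j (u i)) ^ 2)
          (fun _ _ => sq_nonneg _) (Finset.mem_univ j)
    _ ≤ normL2 Ω (u i) ^ 2 + ∑ j, normL2 Ω (weakPartial Ω j (u i)) ^ 2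
        + ∑ j, ∑ l, normL2 Ω (weakPartial Ω l (weakPartial Ω j (u i))) ^ 2 := by
        have : 0 ≤ ∑ j, ∑ l, normL2 Ω (weakPartial Ω l (weakPartial Ω j (u i))) ^ 2 := by
          positivity
        nlinarith [sq_nonneg (normL2 Ω (u i))]
    _ ≤ _ := Finset.single_le_sum (f := fun i => normL2 Ω (u i) ^ 2
        + ∑ j, normL2 Ω (weakPartial Ω j (u i)) ^ 2
        + ∑ j, ∑ l, normL2 Ω (weakPartial Ω l (weakPartial Ω j (u i))) ^ 2)
          (fun _ _ => by positivity) (Finset.mem_univ i)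

lemma eLpNorm_weakPartial_weakPartial_le (hu : FieldMemH2 Ω u) (i j l : Fin 3) :
    eLpNorm (weakPartial Ω l (weakPartial Ω j (u i))) 2 (volOn Ω) ≤ enormH2 Ω u := by
  refine eLpNorm_le_enormH2_of_sq_le (((hu i).2 j).memLp_weakPartial l) ?_
  calc normL2 Ω (weakPartial Ω l (weakPartial Ω j (u i))) ^ 2
      ≤ ∑ l, normL2 Ω (weakPartial Ω l (weakPartial Ω j (u i))) ^ 2 :=
        Finset.single_le_sum
          (f := fun l => normL2 Ω (weakPartial Ω l (weakPartial Ω j (u i))) ^ 2)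
          (fun _ _ => sq_nonneg _) (Finset.mem_univ l)
    _ ≤ ∑ j, ∑ l, normL2 Ω (weakPartial Ω l (weakPartial Ω j (u i))) ^ 2 :=
        Finset.single_le_sum
          (f := fun j => ∑ l, normL2 Ω (weakPartial Ω l (weakPartial Ω j (u i))) ^ 2)
          (fun _ _ => by positivity) (Finset.mem_univ j)
    _ ≤ normL2 Ω (u i) ^ 2 + ∑ j, normL2 Ω (weakPartial Ω j (u i)) ^ 2
        + ∑ j, ∑ l, normL2 Ω (weakPartial Ω l (weakPartial Ω j (u i))) ^ 2 :=
        le_add_of_nonneg_left (by positivity)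
    _ ≤ _ := Finset.single_le_sum (f := fun i => normL2 Ω (u i) ^ 2
        + ∑ j, normL2 Ω (weakPartial Ω j (u i)) ^ 2
        + ∑ j, ∑ l, normL2 Ω (weakPartial Ω l (weakPartial Ω j (u i))) ^ 2)
          (fun _ _ => by positivity) (Finset.mem_univ i)

lemma sobolevNorm_weakPartial_le (hu : FieldMemH2 Ω u) (i j : Fin 3) :
    sobolevNorm Ω (weakPartial Ω j (u i)) (weakGrad Ω (weakPartial Ω j (u i)))
      ≤ 4 * enormH2 Ω u := by
  have h := Finset.sum_le_sum fun (l : Fin 3) (_ : l ∈ Finset.univ) =>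
    eLpNorm_weakPartial_weakPartial_le hu i j l
  have h4 : (4 : ENNReal) = 1 + 3 := by norm_num
  rw [h4, add_mul, one_mul]
  exact add_le_add (eLpNorm_weakPartial_le hu i j) (h.trans_eq (by simp))

lemma sobolevNorm_curl_le (hΩ : IsOpen Ω) (hu : FieldMemH2 Ω u) (i : Fin 3) :
    sobolevNorm Ω (curl Ω u i) (weakGrad Ω (curl Ω u i)) ≤ 8 * enormH2 Ω u := by
  obtain ⟨a, b, h⟩ := exists_curl_eq i
  have h1 := (hu b).2 a
  have h2 := (hu a).2 b
  have e : sobolevNorm Ω (curl Ω u i) (weakGrad Ω (curl Ω u i))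
      = sobolevNorm Ω (weakPartial Ω a (u b) - weakPartial Ω b (u a))
        (weakGrad Ω (weakPartial Ω a (u b)) - weakGrad Ω (weakPartial Ω b (u a))) := by
    rw [h]
    unfold sobolevNorm
    congr 1
    exact Finset.sum_congr rfl fun j _ => eLpNorm_congr_ae (weakPartial_sub hΩ h1 h2 j)
  rw [e]
  refine (sobolevNorm_sub_le h1.1.1 h2.1.1 (fun j => (h1.memLp_weakPartial j).1)
    fun j => (h2.memLp_weakPartial j).1).trans ?_
  refine (add_le_add (sobolevNorm_weakPartial_le hu b a)
    (sobolevNorm_weakPartial_le hu a b)).trans_eq ?_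
  rw [← add_mul]; norm_num

/-- An integral dominated by the product of two `ℓ¹` sums is bounded by the sums of the
`L²` norms. -/
lemma enorm_integral_le_of_abs_le {ι κ : Type} [Fintype ι] [Fintype κ] {μ : Measure E3}
    {f : E3 → ℝ} {A : ι → E3 → ℝ} {B : κ → E3 → ℝ} {a b : ENNReal}
    (hA : ∀ i, MemLp (A i) 2 μ) (hB : ∀ i, MemLp (B i) 2 μ) (ha : ∀ i, eLpNorm (A i) 2 μ ≤ a)
    (hb : ∀ i, eLpNorm (B i) 2 μ ≤ b) (h : ∀ x, |f x| ≤ (∑ i, |A i x|) * ∑ i, |B i x|) :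
    ‖∫ x, f x ∂μ‖ₑ ≤ (Fintype.card ι * a) * (Fintype.card κ * b) := by
  have hsum : ∀ {ι : Type} [Fintype ι] {A : ι → E3 → ℝ} {a : ENNReal},
      (∀ i, MemLp (A i) 2 μ) → (∀ i, eLpNorm (A i) 2 μ ≤ a) →
      AEStronglyMeasurable (fun x => ∑ i, |A i x|) μ ∧
        eLpNorm (fun x => ∑ i, |A i x|) 2 μ ≤ Fintype.card ι * a := by
    intro ι _ A a hA ha
    have e : (fun x => ∑ i, |A i x|) = ∑ i, fun x => ‖A i x‖ := by ext x; simp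
    rw [e]
    refine ⟨Finset.aestronglyMeasurable_sum _ fun i _ => (hA i).1.norm, ?_⟩
    refine (eLpNorm_sum_le (fun i _ => (hA i).1.norm) (by norm_num)).trans ?_
    refine (Finset.sum_le_sum fun i _ => (eLpNorm_norm (A i)).le.trans (ha i)).trans_eq ?_
    simp
  obtain ⟨mA, nA⟩ := hsum hA ha
  obtain ⟨mB, nB⟩ := hsum hB hb
  have h1 : eLpNorm ((fun x => ∑ i, |A i x|) • fun x => ∑ i, |B i x|) 1 μ
      ≤ eLpNorm (fun x => ∑ i, |A i x|) 2 μ * eLpNorm (fun x => ∑ i, |B i x|) 2 μ :=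
    eLpNorm_smul_le_mul_eLpNorm mB mA
  calc ‖∫ x, f x ∂μ‖ₑ ≤ ∫⁻ x, ‖f x‖ₑ ∂μ := enorm_integral_le_lintegral_enorm _
    _ = eLpNorm f 1 μ := eLpNorm_one_eq_lintegral_enorm.symm
    _ ≤ eLpNorm ((fun x => ∑ i, |A i x|) • fun x => ∑ i, |B i x|) 1 μ :=
        eLpNorm_mono_real fun x => h x
    _ ≤ _ := h1.trans (mul_le_mul' nA nB)

/-- Each entry of `A + γ Aᵀ` is at most twice the sum of the entries of `A`; the factor two is the
index set `Fin 2`. -/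
lemma abs_frob_le (γ : ℝ) (hγ : |γ| ≤ 1) (A B : Matrix (Fin 3) (Fin 3) ℝ) :
    |frob (A + γ • Aᵀ) B| ≤ (∑ p : Fin 2 × Fin 3 × Fin 3, |A p.2.1 p.2.2|)
      * ∑ p : Fin 3 × Fin 3, |B p.1 p.2| := by
  have hA : ∀ i j, |A i j| ≤ ∑ q : Fin 3 × Fin 3, |A q.1 q.2| := fun i j =>
    Finset.single_le_sum (f := fun q : Fin 3 × Fin 3 => |A q.1 q.2|)
      (fun _ _ => abs_nonneg _) (Finset.mem_univ (i, j))
  have hS : ∑ p : Fin 2 × Fin 3 × Fin 3, |A p.2.1 p.2.2|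
      = 2 * ∑ q : Fin 3 × Fin 3, |A q.1 q.2| := by
    rw [Fintype.sum_prod_type]; simp
  rw [hS, frob, ← Fintype.sum_prod_type' (f := fun i j => (A + γ • Aᵀ) i j * B i j),
    Finset.mul_sum]
  refine (Finset.abs_sum_le_sum_abs _ _).trans (Finset.sum_le_sum fun p _ => ?_)
  rw [abs_mul]
  refine mul_le_mul_of_nonneg_right ?_ (abs_nonneg _)
  simp only [Matrix.add_apply, Matrix.smul_apply, Matrix.transpose_apply, smul_eq_mul]
  refine (abs_add_le _ _).trans ?_
  rw [abs_mul]
  have h1 := hA p.1 p.2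
  have h2 := mul_le_mul hγ (hA p.2 p.1) (abs_nonneg _) zero_le_one
  linarith

lemma abs_cross_dotProduct_le {n a : Fin 3 → ℝ} (hn : ∀ i, |n i| ≤ 1)
    (T : Fin 3 → Fin 3 → ℝ) :
    |(n ⨯₃ a) ⬝ᵥ (fun i => ∑ j, T i j * n j)|
      ≤ (∑ i, |a i|) * ∑ p : Fin 3 × Fin 3, |T p.1 p.2| := by
  have hm : ∀ i b, |n i * b| ≤ |b| := fun i b => by
    rw [abs_mul]; exact mul_le_of_le_one_left (abs_nonneg _) (hn i)
  have hc : ∀ i, |(n ⨯₃ a) i| ≤ ∑ i, |a i| := by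
    have key : ∀ i j p q, |n i * p - n j * q| ≤ |p| + |q| := fun i j p q =>
      (abs_sub _ _).trans (add_le_add (hm i p) (hm j q))
    intro i
    rw [Fin.sum_univ_three]
    fin_cases i
    · have := key 1 2 (a 2) (a 1)
      simp only [cross_apply]; simp; linarith [abs_nonneg (a 0)]
    · have := key 2 0 (a 0) (a 2)
      simp only [cross_apply]; simp; linarith [abs_nonneg (a 1)]
    · have := key 0 1 (a 1) (a 0)
      simp only [cross_apply]; simp; linarith [abs_nonneg (a 2)]
  rw [Fintype.sum_prod_type, Finset.mul_sum, dotProduct]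
  refine (Finset.abs_sum_le_sum_abs _ _).trans (Finset.sum_le_sum fun i _ => ?_)
  rw [abs_mul]
  refine mul_le_mul (hc i) ((Finset.abs_sum_le_sum_abs _ _).trans
    (Finset.sum_le_sum fun j _ => ?_)) (abs_nonneg _) (Finset.sum_nonneg fun _ _ => abs_nonneg _)
  rw [mul_comm]; exact hm j _

lemma eLpNorm_grad_curl_le (hΩ : IsOpen Ω) (hu : FieldMemH2 Ω u) (i j : Fin 3) :
    eLpNorm (fun x => grad Ω (curl Ω u) x i j) 2 (volOn Ω) ≤ 8 * enormH2 Ω u :=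
  (eLpNorm_le_sobolevNorm' (curl Ω u i) (weakGrad Ω (curl Ω u i)) j).trans
    (sobolevNorm_curl_le hΩ hu i)

/-- The constant is `(18 · 8) (9 · 8)`, from the eighteen entries of `∇ω` and its transpose and the
nine entries of `∇(∇ × φ)`. -/
lemma enorm_volume_term_le (hΩ : IsOpen Ω) {γ : ℝ} (hγ : |γ| ≤ 1) (hu : FieldMemH2 Ω u)
    (hφ : FieldMemH2 Ω φ) :
    ‖∫ x, frob (stressG Ω γ u x) (grad Ω (curl Ω φ) x) ∂(volOn Ω)‖ₑ
      ≤ 10368 * (enormH2 Ω u * enormH2 Ω φ) := by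
  refine (enorm_integral_le_of_abs_le
      (A := fun (p : Fin 2 × Fin 3 × Fin 3) x => grad Ω (curl Ω u) x p.2.1 p.2.2)
      (B := fun (p : Fin 3 × Fin 3) x => grad Ω (curl Ω φ) x p.1 p.2)
      (a := 8 * enormH2 Ω u) (b := 8 * enormH2 Ω φ)
      (fun p => memLp_grad_curl hu _ _) (fun p => memLp_grad_curl hφ _ _)
      (fun p => eLpNorm_grad_curl_le hΩ hu _ _) (fun p => eLpNorm_grad_curl_le hΩ hφ _ _)
      fun x => abs_frob_le γ hγ (grad Ω (curl Ω u) x) (grad Ω (curl Ω φ) x)).trans_eq ?_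
  generalize enormH2 Ω u = a
  generalize enormH2 Ω φ = b
  simp only [Fintype.card_prod, Fintype.card_fin]
  norm_num
  ring

/-- The constant is `(3 · 8) (9 · 4)`, from the three components of `ω` and the nine derivatives
of `φ`. -/
lemma enorm_boundary_term_le (hD : IsC2Domain Ω) {C : ENNReal}
    (hC : ∀ w, MemH1 Ω w → eLpNorm (trace Ω w) 2 (surfaceMeasure Ω)
      ≤ C * sobolevNorm Ω w (weakGrad Ω w))
    (hu : FieldMemH2 Ω u) (hφ : FieldMemH2 Ω φ) :
    ‖∫ x, (nu Ω x ⨯₃ fieldTrace Ω (curl Ω u) x) ⬝ᵥ normalDeriv Ω φ x ∂(surfaceMeasure Ω)‖ₑ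
      ≤ 864 * C ^ 2 * (enormH2 Ω u * enormH2 Ω φ) := by
  refine (enorm_integral_le_of_abs_le
      (A := fun i x => fieldTrace Ω (curl Ω u) x i)
      (B := fun (p : Fin 3 × Fin 3) x => trace Ω (weakPartial Ω p.2 (φ p.1)) x)
      (a := C * (8 * enormH2 Ω u)) (b := C * (4 * enormH2 Ω φ))
      (fun i => hD.memLp_trace (hu.memH1_curl i)) (fun p => hD.memLp_trace ((hφ p.1).2 p.2))
      (fun i => (hC _ (hu.memH1_curl i)).trans
        (mul_le_mul_right (sobolevNorm_curl_le hD.isOpen hu i) _))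
      (fun p => (hC _ ((hφ p.1).2 p.2)).trans
        (mul_le_mul_right (sobolevNorm_weakPartial_le hφ p.1 p.2) _))
      fun x => abs_cross_dotProduct_le (abs_nu_le x)
        fun i j => trace Ω (weakPartial Ω j (φ i)) x).trans_eq ?_
  generalize enormH2 Ω u = a
  generalize enormH2 Ω φ = b
  simp only [Fintype.card_prod, Fintype.card_fin]
  norm_num
  ring

theorem exists_abs_form_le (hD : IsC2Domain Ω) {γ : ℝ} (hγ : |γ| ≤ 1) (k : ℝ) :
    ∃ C : ℝ, 0 < C ∧ ∀ u φ : Field3, FieldMemH2 Ω u → FieldMemH2 Ω φ →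
      |form Ω γ k u φ| ≤ C * normH2 Ω u * normH2 Ω φ := by
  obtain ⟨C, hC⟩ := exists_eLpNorm_trace_le hD.isBounded hD.hasPatches
  obtain ⟨K, hK0, hK⟩ : ∃ K : NNReal, 0 < K ∧
      (10368 + ‖k‖ₑ * (864 * (C : ENNReal) ^ 2)) = K :=
    ⟨10368 + ‖k‖₊ * (864 * C ^ 2), by positivity, by push_cast; rw [enorm_eq_nnnorm]⟩
  refine ⟨K, NNReal.coe_pos.2 hK0, fun u φ hu hφ => ?_⟩
  have h3 : ‖form Ω γ k u φ‖ₑ ≤ K * (enormH2 Ω u * enormH2 Ω φ) := by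
    rw [form, ← hK, add_mul, mul_assoc ‖k‖ₑ]
    refine (enorm_add_le _ _).trans
      (add_le_add (enorm_volume_term_le hD.isOpen hγ hu hφ) ?_)
    rw [enorm_mul]
    exact mul_le_mul_right (enorm_boundary_term_le hD
      (fun w hw => hC _ _ (hD.isTrace_trace hw)) hu hφ) _
  have hn : ∀ u : Field3, 0 ≤ normH2 Ω u := fun u => Real.sqrt_nonneg _
  have h4 := ENNReal.toReal_mono (ENNReal.mul_ne_top ENNReal.coe_ne_top
    (ENNReal.mul_ne_top ENNReal.ofReal_ne_top ENNReal.ofReal_ne_top)) h3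
  rw [toReal_enorm, Real.norm_eq_abs, ENNReal.toReal_mul, ENNReal.toReal_mul,
    ENNReal.toReal_ofReal (hn u), ENNReal.toReal_ofReal (hn φ), ENNReal.coe_toReal] at h4
  rwa [mul_assoc]

/-! ### The vorticity on the boundary, and symmetry -/

/-- On the boundary, the gradient of a field of `H² ∩ H¹₀` is `∂ₙu ⊗ n`, so that its curl is
`n × ∂ₙu`. -/
theorem ae_fieldTrace_curl_eq (hD : IsC2Domain Ω) (hu : FieldMemH2 Ω u)
    (hu0 : FieldMemH10 Ω u) : ∀ᵐ x ∂(surfaceMeasure Ω),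
      fieldTrace Ω (curl Ω u) x = nu Ω x ⨯₃ normalDeriv Ω u x := by
  have hT : ∀ i j l : Fin 3, ∀ᵐ x ∂(surfaceMeasure Ω),
      nu Ω x l * trace Ω (weakPartial Ω j (u i)) x
        = nu Ω x j * trace Ω (weakPartial Ω l (u i)) x := fun i j l =>
    ae_nu_mul_trace_eq hD.isOpen hD.isBounded hD.hasPatches (hu i) (hu0 i)
      (hD.isTrace_trace ((hu i).2 l)) (hD.isTrace_trace ((hu i).2 j))
  have hn : ∀ᵐ x ∂(surfaceMeasure Ω), ∑ j, nu Ω x j * nu Ω x j = 1 := by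
    filter_upwards [ae_restrict_mem (μ := μHE[2]) isClosed_frontier.measurableSet] with x hx
    obtain ⟨P⟩ := hD.hasPatches x hx
    have h := P.isNormal x ⟨hx, Metric.mem_ball_self P.r_pos⟩
    rw [← h.outwardNormal_eq] at h
    have h1 := h.1
    rw [EuclideanSpace.norm_eq, Real.sqrt_eq_one] at h1
    simpa [nu, sq] using h1
  -- on the boundary, `∂ⱼ uᵢ` is the normal component of the gradient times `nⱼ`
  have hd : ∀ᵐ x ∂(surfaceMeasure Ω), ∀ i l,
      trace Ω (weakPartial Ω l (u i)) x = nu Ω x l * normalDeriv Ω u x i := by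
    filter_upwards [eventually_all.2 fun i => eventually_all.2 fun j => eventually_all.2 (hT i j),
      hn] with x h1 h2 i l
    rw [normalDeriv, Finset.mul_sum]
    calc trace Ω (weakPartial Ω l (u i)) x
        = (∑ j, nu Ω x j * nu Ω x j) * trace Ω (weakPartial Ω l (u i)) x := by rw [h2, one_mul]
      _ = _ := by
          rw [Finset.sum_mul]
          refine Finset.sum_congr rfl fun j _ => ?_
          linear_combination (-nu Ω x j) * h1 i j l
  have hc : ∀ a b : Fin 3, trace Ω (weakPartial Ω a (u b) - weakPartial Ω b (u a))
      =ᵐ[surfaceMeasure Ω] trace Ω (weakPartial Ω a (u b)) - trace Ω (weakPartial Ω b (u a)) :=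
    fun a b => hD.trace_sub ((hu b).2 a) ((hu a).2 b)
  filter_upwards [hd, hc 1 2, hc 2 0, hc 0 1] with x h1 c0 c1 c2
  ext i
  rw [cross_apply]
  fin_cases i
  · exact c0.trans (by simp [h1])
  · exact c1.trans (by simp [h1])
  · exact c2.trans (by simp [h1])

lemma frob_add_transpose_comm (γ : ℝ) (A B : Matrix (Fin 3) (Fin 3) ℝ) :
    frob (A + γ • Aᵀ) B = frob (B + γ • Bᵀ) A := by
  simp only [frob, Fin.sum_univ_three, Matrix.add_apply, Matrix.smul_apply,
    Matrix.transpose_apply, smul_eq_mul]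
  ring

/-- The map `p ↦ n × (n × p)` is `n nᵀ - |n|²`, a symmetric matrix. -/
lemma cross_cross_dotProduct_comm (n p q : Fin 3 → ℝ) :
    (n ⨯₃ (n ⨯₃ p)) ⬝ᵥ q = (n ⨯₃ (n ⨯₃ q)) ⬝ᵥ p := by
  simp only [dotProduct, Fin.sum_univ_three, cross_apply]
  simp
  ring

theorem form_comm (hD : IsC2Domain Ω) (γ k : ℝ) (hu : FieldMemH2 Ω u) (hu0 : FieldMemH10 Ω u)
    (hφ : FieldMemH2 Ω φ) (hφ0 : FieldMemH10 Ω φ) : form Ω γ k u φ = form Ω γ k φ u := by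
  unfold form
  congr 1
  · congr 1; ext x
    exact frob_add_transpose_comm γ _ _
  · congr 1
    refine integral_congr_ae ?_
    filter_upwards [ae_fieldTrace_curl_eq hD hu hu0, ae_fieldTrace_curl_eq hD hφ hφ0] with x h1 h2
    rw [h1, h2]
    exact cross_cross_dotProduct_comm _ _ _

end

end WallEddy

end

open WallEddy in
theorem theorem2p3 (Ω : Set E3) (hΩo : IsOpen Ω) (hΩb : Bornology.IsBounded Ω)
    (hΩ : HasC2Boundary Ω) (γ ℓ β : ℝ) (hγ : |γ| ≤ 1) (hℓ : 0 < ℓ) (hβ : 0 < β) :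
    -- the boundary values entering the form are well defined
    (∀ x ∈ frontier Ω, ∃! n, IsOutwardUnitNormal Ω x n) ∧
    (∀ w, MemH1 Ω w → ∃ g, IsTrace Ω w g ∧
      ∀ g', IsTrace Ω w g' → g' =ᵐ[surfaceMeasure Ω] g) ∧
    -- the form is bilinear
    (∀ (c : ℝ) (u v φ : Field3), FieldMemH2 Ω u → FieldMemH2 Ω v → FieldMemH2 Ω φ →
      form Ω γ (ℓ / β ^ 2) (c • u + v) φ
          = c * form Ω γ (ℓ / β ^ 2) u φ + form Ω γ (ℓ / β ^ 2) v φ ∧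
      form Ω γ (ℓ / β ^ 2) φ (c • u + v)
          = c * form Ω γ (ℓ / β ^ 2) φ u + form Ω γ (ℓ / β ^ 2) φ v) ∧
    -- continuity
    (∃ C : ℝ, 0 < C ∧ ∀ u φ : Field3, FieldMemH2 Ω u → FieldMemH2 Ω φ →
      |form Ω γ (ℓ / β ^ 2) u φ| ≤ C * normH2 Ω u * normH2 Ω φ) ∧
    -- the vorticity on the boundary
    (∀ u : Field3, FieldMemH2 Ω u → FieldMemH10 Ω u →
      ∀ᵐ x ∂(surfaceMeasure Ω),
        fieldTrace Ω (curl Ω u) x = nu Ω x ⨯₃ normalDeriv Ω u x) ∧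
    -- symmetry
    (∀ u φ : Field3, FieldMemH2 Ω u → FieldMemH10 Ω u → FieldMemH2 Ω φ → FieldMemH10 Ω φ →
      form Ω γ (ℓ / β ^ 2) u φ = form Ω γ (ℓ / β ^ 2) φ u) := by
  have hD : IsC2Domain Ω := ⟨hΩo, hΩb, hΩ⟩
  refine ⟨fun x hx => ?_, fun w hw => ?_, fun c u v φ hu hv hφ => ?_, ?_, ?_, ?_⟩
  · obtain ⟨P⟩ := hD.hasPatches x hx
    exact ⟨_, P.isNormal x ⟨hx, Metric.mem_ball_self P.r_pos⟩, fun n hn =>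
      hn.eq (P.isNormal x ⟨hx, Metric.mem_ball_self P.r_pos⟩)⟩
  · exact ⟨_, hD.isTrace_trace hw, fun g' hg' =>
      (hD.isTrace_trace hw).ae_eq hΩb hD.hasPatches hg'⟩
  · exact ⟨form_const_smul_add_left hD γ _ c hu hv hφ,
      form_const_smul_add_right hD γ _ c hu hv hφ⟩
  · exact exists_abs_form_le hD hγ _
  · exact fun u hu hu0 => ae_fieldTrace_curl_eq hD hu hu0
  · exact fun u φ hu hu0 hφ hφ0 => form_comm hD γ _ hu hu0 hφ hφ0
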